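/- **Setting.** A finite directed graph $G$ has finite sets $G^0$ of vertices and $G^1$ of edges and maps $i,t:G^1\to G^0$ (initial and terminal vertex); it is primitive if some positive power of its adjacency matrix has only positive entries. $X_G^+$ and $X_G$ are the spaces of one-sided paths $(x_1,x_2,\dots)$ and of bi-infinite paths $(x_n)_{n\in\mathbb Z}$ in $G$ (that is, $t(x_n)=i(x_{n+1})$), with the product topology, the shift $\sigma(x)_n=x_{n+1}$ and the metrics $d_G(x,y)=\inf\{2^{-n}: n\ge 0,\ x_j=y_j \text{ for } 1\le j\le n\}$ on $X_G^+$ and $d_G(x,y)=\inf\{2^{-n}: n\ge 0,\ x_j=y_j\text{ for }1-n\le j\le n\}$ on $X_G$. On $X_G$ put $[x,y]=(\dots,y_{-1},y_0,x_1,x_2,\dots)$, defined when $d_G(x,y)\le 2^{-1}$. Let $G,H$ be finite directed graphs with $G$ primitive and let $\xi^0,\xi^1:H\to G$ be injective graph homomorphisms such that (H0) $\xi^0=\xi^1$ on $H^0$; (H1) $\xi^0(H^1)\cap\xi^1(H^1)=\emptyset$; (H2) for each $y\in H^1$ there is an edge $x\in G^1\setminus\xi(H^1)$ with $i(x)=i(\xi^0(y))$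 and $t(x)=t(\xi^0(y))$, where $\xi(H^1)=\xi^0(H^1)\cup\xi^1(H^1)$. Assume also that $X_H\neq\emptyset$. *The one-sided factor.* On $X_G^+$ let $x\sim_\xi x'$ if $x=x'$, or if for some $i\in\{0,1\}$ and edges $y_k$ of $H$ one of the following holds: (1) for some $n\ge1$, $x_k=x'_k$ for $k<n$, $x_n=\xi^{1-i}(y_n)$, $x'_n=\xi^i(y_n)$, and $x_k=\xi^i(y_k)$, $x'_k=\xi^{1-i}(y_k)$ for $k>n$; (2) for some $n\ge0$, $x_k=x'_k$ for $k\le n$, $x_n\notin\xi(H^1)$ if $n\ge1$, and $x_k=\xi^i(y_k)$, $x'_k=\xi^{1-i}(y_k)$ for $k>n$. Let $X_\xi^+=X_G^+/\!\sim_\xi$, with the quotient topology, quotient map $\pi_\xi$ and induced map $\sigma_\xi$. *The metric.* Let $G_\xi$ be $G$ with the edges $\xi^0(y)$ and $\xi^1(y)$ identified for each $y\in H^1$, and let $\tau_\xi:X_G^+\to X_{G_\xi}^+$ be the induced map. For $x\in X_G^+$ let $\kappa(x)\in\{0,1,\dots,\infty\}$ be the number of $n\ge1$ with $x_n\notin\xi(H^1)$,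 let $n(x)$ be the least such $n$ if $\kappa(x)>0$ and $n(x)=\infty$ otherwise, and let $\theta(x)=\exp\bigl(2\pi i\sum_{1\le j<n(x)}\varepsilon(x_j)2^{-j}\bigr)$, where $e\in\xi^{\varepsilon(e)}(H^1)$. Let $d_{\mathbb T}$ be arc length on the unit circle, normalized to total length $1$. For $\kappa(x)=\kappa(y)=0$ let $\lambda_0(x,y)=d_{\mathbb T}(\theta(x),\theta(y))$, and for $\kappa(x)=\kappa(y)=k$ with $1\le k<\infty$ let $$\lambda_k(x,y)=|2^{-n(x)}-2^{-n(y)}|+d_{\mathbb T}(\theta(x),\theta(y))+\delta\,2^{-2-n(x)}\lambda_{k-1}(\sigma^{n(x)}(x),\sigma^{n(y)}(y)),$$ where $\delta=1$ if $(n(x),\theta(x))=(n(y),\theta(y))$ and $\delta=0$ otherwise. The functions $d_k=d_{G_\xi}(\tau_\xi(\cdot),\tau_\xi(\cdot))+\lambda_k$ on $\kappa^{-1}\{k\}\times\kappa^{-1}\{k\}$, $k<\infty$, have a common continuous extension $d$ to $X_G^+\times X_G^+$; it is a pseudo-metric with $d(x,y)=0$ if and only if $x\sim_\xi y$, and $d_\xi$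 denotes the induced metric on $X_\xi^+$. *The two-sided factor.* Let $X_\xi=\{(x^n)_{n\ge0}: x^n\in X_\xi^+,\ x^n=\sigma_\xi(x^{n+1})\}$ be the inverse limit, with $\sigma_\xi(x)^n=\sigma_\xi(x^n)$ and $d_\xi(x,y)=\sup_{n\ge0}2^{-n}d_\xi(x^n,y^n)$, and let $\pi_\xi:X_G\to X_\xi$ be $\pi_\xi(x)^n=\pi_\xi(x_{1-n},x_{2-n},\dots)$. For $x,y\in X_\xi$ with $d_\xi(x,y)\le2^{-1}$, the bracket $[x,y]$ is defined, and equal to $z$, if $z$ is the unique element of $X_\xi$ with $z^0=x^0$ and $d_\xi(z^n,y^n)\le2^{-n-1}$ for all $n\ge0$. The stable set of $x$ in a system $(X,d,\varphi)$ is $X^s(x)=\{y: d(\varphi^n(x),\varphi^n(y))\to0 \text{ as } n\to+\infty\}$. **Theorem 4.3.** 1. $\pi_\xi:(X_G,d_G,\sigma)\to(X_\xi,d_\xi,\sigma_\xi)$ is a factor map: it is continuous (for the inverse limit topology and for $d_\xi$), surjective, and $\pi_\xi\circ\sigma=\sigma_\xi\circ\pi_\xi$. 2. If $x,y\in X_G$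 and $d_G(x,y)\le2^{-3}$, then $[x,y]$ and $[\pi_\xi(x),\pi_\xi(y)]$ are both defined and $\pi_\xi([x,y])=[\pi_\xi(x),\pi_\xi(y)]$. 3. For $x,y\in X_G$, $\pi_\xi(x)=\pi_\xi(y)$ if and only if exactly one of the following holds: (a) $x=y$; (b) there are $i\in\{0,1\}$ and $z\in X_H$ with $x_n=\xi^i(z_n)$ and $y_n=\xi^{1-i}(z_n)$ for all $n\in\mathbb Z$; (c) there are $m\in\mathbb Z$, $i\in\{0,1\}$ and an infinite path $(z_n)_{n>m}$ in $H$ such that $x_n=y_n$ for all $n<m$; $x_n=\xi^i(z_n)$ and $y_n=\xi^{1-i}(z_n)$ for all $n>m$; and either $x_m=y_m\notin\xi(H^1)$, or $x_m=\xi^{1-i}(z_m)$ and $y_m=\xi^i(z_m)$ for some edge $z_m$ of $H$ with $t(z_m)=i(z_{m+1})$. In particular, every fibre of $\pi_\xi$ has at most two points. 4. $\pi_\xi$ is $s$-bijective: for every $x\in X_G$, $\pi_\xi$ restricts to a bijection from $X_G^s(x)$ onto $X_\xi^s(\pi_\xi(x))$. -/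

import Mathlib

open Set Filter Topology

noncomputable section

namespace XiFactor

/-- A directed graph (multi-edges and loops allowed) with vertex set `V`, edge set `E`,
and initial and terminal vertex maps `i`, `t`. -/
structure EdgeGraph (V E : Type*) where
  i : E → V
  t : E → V

/-- The adjacency matrix: the entry `(v, w)` is the number of edges from `w` to `v`. -/
def EdgeGraph.adj {V E : Type*} (G : EdgeGraph V E) : Matrix V V ℕ :=
  fun v w => Nat.card {e : E // G.i e = w ∧ G.t e = v}

/-- Some positive power of the adjacency matrix has only positive entries. -/
def EdgeGraph.IsPrimitive {V E : Type*} [Fintype V] [DecidableEq V] (G : EdgeGraph V E) : Prop :=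
  ∃ k : ℕ, 0 < k ∧ ∀ v w : V, 0 < (G.adj ^ k) w v

/-- Graph embeddings: injective graph homomorphisms. -/
structure Embedding {W F V E : Type*} (H : EdgeGraph W F) (G : EdgeGraph V E) where
  onV : W → V
  onE : F → E
  map_i : ∀ e, G.i (onE e) = onV (H.i e)
  map_t : ∀ e, G.t (onE e) = onV (H.t e)
  injV : Function.Injective onV
  injE : Function.Injective onE

/-! ### Path spaces -/

/-- One-sided infinite paths `(x₁, x₂, …)`; the entry `x_{k+1}` is `x.val k`. -/
@[ext]
structure OneSided {V E : Type*} (G : EdgeGraph V E) where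
  val : ℕ → E
  isPath : ∀ n, G.t (val n) = G.i (val (n + 1))

/-- Bi-infinite paths, indexed by the integers. -/
@[ext]
structure TwoSided {V E : Type*} (G : EdgeGraph V E) where
  val : ℤ → E
  isPath : ∀ n, G.t (val n) = G.i (val (n + 1))

/-- The topology of the one-sided path space: subspace of the product of discrete spaces. -/
instance {V E : Type*} (G : EdgeGraph V E) : TopologicalSpace (OneSided G) :=
  TopologicalSpace.induced (fun x : OneSided G => x.val)
    (@Pi.topologicalSpace ℕ (fun _ => E) (fun _ => ⊥))

/-- The topology of the two-sided path space: subspace of the product of discrete spaces. -/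
instance {V E : Type*} (G : EdgeGraph V E) : TopologicalSpace (TwoSided G) :=
  TopologicalSpace.induced (fun x : TwoSided G => x.val)
    (@Pi.topologicalSpace ℤ (fun _ => E) (fun _ => ⊥))

/-- `d_G` on one-sided paths: `inf {2⁻ⁿ | x, y agree in the first n entries}`. -/
def dPos {V E : Type*} {G : EdgeGraph V E} (x y : OneSided G) : ℝ :=
  sInf {r : ℝ | ∃ n : ℕ, r = (2 : ℝ)⁻¹ ^ n ∧ ∀ k, k < n → x.val k = y.val k}

/-- `d_G` on bi-infinite paths: `inf {2⁻ⁿ | x_j = y_j for 1 - n ≤ j ≤ n}`. -/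
def dTwo {V E : Type*} {G : EdgeGraph V E} (x y : TwoSided G) : ℝ :=
  sInf {r : ℝ | ∃ n : ℕ, r = (2 : ℝ)⁻¹ ^ n ∧ ∀ j : ℤ, 1 - (n : ℤ) ≤ j → j ≤ n → x.val j = y.val j}

/-- The shift on one-sided paths. -/
def shiftPos {V E : Type*} {G : EdgeGraph V E} (x : OneSided G) : OneSided G :=
  ⟨fun n => x.val (n + 1), fun n => x.isPath (n + 1)⟩

/-- The shift on bi-infinite paths. -/
def shiftTwo {V E : Type*} {G : EdgeGraph V E} (x : TwoSided G) : TwoSided G :=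
  ⟨fun n => x.val (n + 1), fun n => x.isPath (n + 1)⟩

/-- The one-sided path `χ⁺(σ⁻ⁿ(x)) = (x_{1-n}, x_{2-n}, …)`. -/
def tailFrom {V E : Type*} {G : EdgeGraph V E} (x : TwoSided G) (n : ℕ) : OneSided G :=
  ⟨fun k => x.val (1 + (k : ℤ) - n), fun k => by
    have h := x.isPath (1 + (k : ℤ) - n)
    rwa [show 1 + (k : ℤ) - n + 1 = 1 + ((k + 1 : ℕ) : ℤ) - n by push_cast; ring] at h⟩

theorem dTwo_le_half {V E : Type*} {G : EdgeGraph V E} {x y : TwoSided G}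
    (h : dTwo x y ≤ 2⁻¹) : x.val 0 = y.val 0 ∧ x.val 1 = y.val 1 := by
  have h1 : dTwo x y < 1 := lt_of_le_of_lt h (by norm_num)
  obtain ⟨r, ⟨n, rfl, hn⟩, hr⟩ := exists_lt_of_csInf_lt
    (show Set.Nonempty {r : ℝ | ∃ n : ℕ, r = (2 : ℝ)⁻¹ ^ n ∧
      ∀ j : ℤ, 1 - (n : ℤ) ≤ j → j ≤ n → x.val j = y.val j} from
      ⟨1, 0, by simp, fun j h2 h3 => by push_cast at h2 h3; omega⟩) h1
  have hn0 : n ≠ 0 := by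
    rintro rfl
    simp at hr
  exact ⟨hn 0 (by omega) (by omega), hn 1 (by omega) (by omega)⟩

/-- The bracket `[x, y] = (…, y₋₁, y₀, x₁, x₂, …)` on bi-infinite paths,
defined for `d_G(x, y) ≤ 1/2`. -/
def bracketTwo {V E : Type*} {G : EdgeGraph V E} (x y : TwoSided G) (h : dTwo x y ≤ 2⁻¹) :
    TwoSided G :=
  ⟨fun n => if n ≤ 0 then y.val n else x.val n, fun n => by
    rcases lt_trichotomy n 0 with hn | hn | hn
    · rw [if_pos hn.le, if_pos (by omega)]
      exact y.isPath n
    · subst hn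
      simp only [le_refl, if_true]
      rw [if_neg (by omega), ← (dTwo_le_half h).1]
      exact x.isPath 0
    · rw [if_neg (by omega), if_neg (by omega)]
      exact x.isPath n⟩

/-! ### The combinatorial data `ξ = (ξ⁰, ξ¹)` -/

section Data

variable {W F V E : Type*} {H : EdgeGraph W F} {G : EdgeGraph V E} (ξ : Fin 2 → Embedding H G)

/-- `ξ(H¹) = ξ⁰(H¹) ∪ ξ¹(H¹)`. -/
def imageEdges : Set E := range (ξ 0).onE ∪ range (ξ 1).onE

/-- `G` is primitive and `ξ` satisfies (H0), (H1), (H2). -/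
structure StandingHypotheses [Fintype V] [DecidableEq V] : Prop where
  primitive : G.IsPrimitive
  h0 : (ξ 0).onV = (ξ 1).onV
  h1 : range (ξ 0).onE ∩ range (ξ 1).onE = ∅
  h2 : ∀ y : F, ∃ x : E, G.t x = G.t ((ξ 0).onE y) ∧ G.i x = G.i ((ξ 0).onE y) ∧
    x ∉ imageEdges ξ

open Classical in
/-- `ε(e) ∈ {0, 1}` with `e ∈ ξ^{ε(e)}(H¹)`, for edges `e ∈ ξ(H¹)`. -/
def eps (e : E) : ℝ := if e ∈ range (ξ 1).onE then 1 else 0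

/-- The endpoints are unchanged when `ξ⁰(y)` and `ξ¹(y)` are identified. -/
theorem endpoints_eq (h0 : (ξ 0).onV = (ξ 1).onV) (y : F) :
    G.i ((ξ 0).onE y) = G.i ((ξ 1).onE y) ∧ G.t ((ξ 0).onE y) = G.t ((ξ 1).onE y) := by
  simp [(ξ 0).map_i, (ξ 1).map_i, (ξ 0).map_t, (ξ 1).map_t, h0]

/-- The edges of `G_ξ`: edges of `G` with `ξ⁰(y)` and `ξ¹(y)` identified, for each `y`. -/
def QuotEdge := Quot fun e f : E => ∃ y : F, e = (ξ 0).onE y ∧ f = (ξ 1).onE y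

/-- The graph `G_ξ`. -/
def quotGraph (h0 : (ξ 0).onV = (ξ 1).onV) : EdgeGraph V (QuotEdge ξ) where
  i := Quot.lift G.i (by rintro _ _ ⟨y, rfl, rfl⟩; exact (endpoints_eq ξ h0 y).1)
  t := Quot.lift G.t (by rintro _ _ ⟨y, rfl, rfl⟩; exact (endpoints_eq ξ h0 y).2)

/-- `τ_ξ` on one-sided paths. -/
def tau (h0 : (ξ 0).onV = (ξ 1).onV) (x : OneSided G) : OneSided (quotGraph ξ h0) :=
  ⟨fun n => Quot.mk _ (x.val n), fun n => x.isPath n⟩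

/-- `κ(x)`: the number of entries of `x` outside `ξ(H¹)`. -/
def kappa (x : OneSided G) : ℕ∞ := {n : ℕ | x.val n ∉ imageEdges ξ}.encard

/-- `n(x)`: the least positive `n` such that the entry `x_n` is outside `ξ(H¹)`
(only used when `κ(x) > 0`). -/
def firstOut (x : OneSided G) : ℕ := sInf {n : ℕ | x.val n ∉ imageEdges ξ} + 1

open Classical in
/-- The point `θ(x)` of the unit circle. -/
def theta (x : OneSided G) : ℂ :=
  if kappa ξ x = 0 then
    Complex.exp (2 * Real.pi * Complex.I *
      ((∑' k : ℕ, eps ξ (x.val k) * (2 : ℝ)⁻¹ ^ (k + 1) : ℝ) : ℂ))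
  else
    Complex.exp (2 * Real.pi * Complex.I *
      ((∑ k ∈ Finset.range (firstOut ξ x - 1), eps ξ (x.val k) * (2 : ℝ)⁻¹ ^ (k + 1) : ℝ) : ℂ))

/-- The distance on the unit circle, of total length `1`. -/
def dCircle (a b : ℂ) : ℝ :=
  sInf {r : ℝ | ∃ s : ℝ, r = |s| ∧ Complex.exp (2 * Real.pi * Complex.I * (s : ℂ)) * a = b}

open Classical in
/-- The functions `λ_k`, meaningful on pairs with `κ(x) = κ(y) = k`. -/
def lam : ℕ → OneSided G → OneSided G → ℝ
  | 0, x, y => dCircle (theta ξ x) (theta ξ y)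
  | k + 1, x, y =>
      |(2 : ℝ)⁻¹ ^ firstOut ξ x - (2 : ℝ)⁻¹ ^ firstOut ξ y| + dCircle (theta ξ x) (theta ξ y) +
        if firstOut ξ x = firstOut ξ y ∧ theta ξ x = theta ξ y then
          (2 : ℝ)⁻¹ ^ (2 + firstOut ξ x) *
            lam k (shiftPos^[firstOut ξ x] x) (shiftPos^[firstOut ξ y] y)
        else 0

/-- The pseudo-metrics `d_k(x, y) = d_{G_ξ}(τ_ξ(x), τ_ξ(y)) + λ_k(x, y)` on `κ⁻¹{k}`. -/
def dLevel (h0 : (ξ 0).onV = (ξ 1).onV) (k : ℕ) (x y : OneSided G) : ℝ :=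
  dPos (tau ξ h0 x) (tau ξ h0 y) + lam ξ k x y

/-- The pseudo-metric `d` on one-sided paths: the common extension by continuity of the `d_k`,
`k = 0, 1, 2, …`, from the union of the sets `κ⁻¹{k} × κ⁻¹{k}`. -/
def dExt (h0 : (ξ 0).onV = (ξ 1).onV) (x y : OneSided G) : ℝ :=
  extendFrom {p : OneSided G × OneSided G | kappa ξ p.1 = kappa ξ p.2 ∧ kappa ξ p.1 ≠ ⊤}
    (fun p => dLevel ξ h0 (kappa ξ p.1).toNat p.1 p.2) (x, y)

/-! ### The one-sided factor -/

/-- `x = (…, ξ^{1-i}(y_n), ξ^i(y_{n+1}), …)`, `x' = (…, ξ^i(y_n), ξ^{1-i}(y_{n+1}), …)`. -/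
def Flip₁ (x x' : OneSided G) : Prop :=
  ∃ (n : ℕ) (i : Fin 2) (y : ℕ → F),
    (∀ k, k < n → x.val k = x'.val k) ∧
    x.val n = (ξ (1 - i)).onE (y n) ∧ x'.val n = (ξ i).onE (y n) ∧
    ∀ k, n < k → x.val k = (ξ i).onE (y k) ∧ x'.val k = (ξ (1 - i)).onE (y k)

/-- `x = (x₁, …, x_n, ξ^i(y_{n+1}), …)`, `x' = (x₁, …, x_n, ξ^{1-i}(y_{n+1}), …)` with
`x_n ∉ ξ(H¹)`; this last condition is void if `n = 0`. -/
def Flip₂ (x x' : OneSided G) : Prop :=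
  ∃ (n : ℕ) (i : Fin 2) (y : ℕ → F),
    (∀ k, k < n → x.val k = x'.val k) ∧
    (∀ k, k + 1 = n → x.val k ∉ imageEdges ξ) ∧
    ∀ k, n ≤ k → x.val k = (ξ i).onE (y k) ∧ x'.val k = (ξ (1 - i)).onE (y k)

/-- The relation `∼_ξ`. -/
def Rel (x x' : OneSided G) : Prop := x = x' ∨ Flip₁ ξ x x' ∨ Flip₂ ξ x x'

theorem Rel.shift {x x' : OneSided G} (h : Rel ξ x x') : Rel ξ (shiftPos x) (shiftPos x') := by
  rcases h with rfl | ⟨n, i, y, h1, h2, h3, h4⟩ | ⟨n, i, y, h1, h2, h3⟩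
  · exact Or.inl rfl
  · cases n with
    | zero =>
      exact Or.inr (Or.inr ⟨0, i, fun k => y (k + 1), fun k hk => absurd hk (by omega),
        fun k hk => absurd hk (by omega), fun k _ => h4 (k + 1) (by omega)⟩)
    | succ n =>
      exact Or.inr (Or.inl ⟨n, i, fun k => y (k + 1), fun k hk => h1 (k + 1) (by omega), h2, h3,
        fun k hk => h4 (k + 1) (by omega)⟩)
  · cases n with
    | zero =>
      exact Or.inr (Or.inr ⟨0, i, fun k => y (k + 1), fun k hk => absurd hk (by omega),
        fun k hk => absurd hk (by omega), fun k _ => h3 (k + 1) (by omega)⟩)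
    | succ n =>
      exact Or.inr (Or.inr ⟨n, i, fun k => y (k + 1), fun k hk => h1 (k + 1) (by omega),
        fun k hk => h2 (k + 1) (by omega), fun k hk => h3 (k + 1) (by omega)⟩)

/-- `X_ξ⁺`, the quotient of the one-sided path space by `∼_ξ`, with the quotient topology. -/
abbrev QuotPos := Quot (Rel ξ)

/-- The quotient map `π_ξ` on one-sided paths. -/
def piPos (x : OneSided G) : QuotPos ξ := Quot.mk (Rel ξ) x

/-- `σ_ξ` on `X_ξ⁺`. -/
def shiftQuot : QuotPos ξ → QuotPos ξ := Quot.map shiftPos fun _ _ h => Rel.shift ξ h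

/-- The metric `d_ξ` on `X_ξ⁺` induced by the pseudo-metric `d`, evaluated on representatives. -/
def dQuot (h0 : (ξ 0).onV = (ξ 1).onV) (p q : QuotPos ξ) : ℝ :=
  dExt ξ h0 (Quot.out p) (Quot.out q)

/-! ### The inverse limit -/

/-- `X_ξ`, the inverse limit of `X_ξ⁺ ← X_ξ⁺ ← ⋯` along `σ_ξ`. -/
@[ext]
structure InvLim where
  val : ℕ → QuotPos ξ
  compat : ∀ n, val n = shiftQuot ξ (val (n + 1))

/-- The inverse limit topology: subspace of the product. -/
instance : TopologicalSpace (InvLim ξ) :=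
  TopologicalSpace.induced (fun x : InvLim ξ => x.val) inferInstance

/-- `σ_ξ` on `X_ξ`. -/
def shiftLim (x : InvLim ξ) : InvLim ξ :=
  ⟨fun n => shiftQuot ξ (x.val n), fun n => congrArg (shiftQuot ξ) (x.compat n)⟩

/-- `d_ξ` on `X_ξ`: `sup {2⁻ⁿ d_ξ(xⁿ, yⁿ) | n ≥ 0}`. -/
def dLim (h0 : (ξ 0).onV = (ξ 1).onV) (x y : InvLim ξ) : ℝ :=
  ⨆ n : ℕ, (2 : ℝ)⁻¹ ^ n * dQuot ξ h0 (x.val n) (y.val n)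

/-- `π_ξ : X_G → X_ξ`, sending `x` to the sequence `π_ξ(χ⁺(σ⁻ⁿ(x)))`, `n ≥ 0`. -/
def piTwo (x : TwoSided G) : InvLim ξ :=
  ⟨fun n => piPos ξ (tailFrom x n), fun n => by
    have h : tailFrom x n = shiftPos (tailFrom x (n + 1)) := by
      ext k
      simp only [tailFrom, shiftPos]
      congr 1
      push_cast
      ring
    exact congrArg (Quot.mk (Rel ξ)) h⟩

/-- `z` is a value of the bracket `[x, y]` on `X_ξ`: `d_ξ(x, y) ≤ 1/2`, `z⁰ = x⁰` and
`d_ξ(zⁿ, yⁿ) ≤ 2⁻ⁿ⁻¹` for all `n` (and `σ_ξ(zⁿ⁺¹) = zⁿ`, since `z ∈ X_ξ`). -/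
def IsBracket (h0 : (ξ 0).onV = (ξ 1).onV) (x y z : InvLim ξ) : Prop :=
  dLim ξ h0 x y ≤ 2⁻¹ ∧ z.val 0 = x.val 0 ∧
    ∀ n : ℕ, dQuot ξ h0 (z.val n) (y.val n) ≤ (2 : ℝ)⁻¹ ^ (n + 1)

/-- `x = ξ^i(z)` and `y = ξ^{1-i}(z)` for a bi-infinite path `z` in `H`. -/
def FullFlip (x y : TwoSided G) : Prop :=
  ∃ (i : Fin 2) (z : TwoSided H), ∀ n : ℤ,
    x.val n = (ξ i).onE (z.val n) ∧ y.val n = (ξ (1 - i)).onE (z.val n)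

/-- There are an integer `m`, `i ∈ {0, 1}` and a path `z_{m+1}, z_{m+2}, …` in `H` with
`x_n = y_n` for `n < m`; with `x_n = ξ^i(z_n)`, `y_n = ξ^{1-i}(z_n)` for `n > m`; and either
`x_m = y_m ∉ ξ(H¹)`, or `x_m = ξ^{1-i}(e)`, `y_m = ξ^i(e)` for an edge `e = z_m` of `H` such that
`z_m, z_{m+1}, …` is still a path. The entry `z_{m+1+k}` is `z.val k`. -/
def TailFlip (x y : TwoSided G) : Prop :=
  ∃ (m : ℤ) (i : Fin 2) (z : OneSided H),
    (∀ n, n < m → x.val n = y.val n) ∧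
    ((x.val m = y.val m ∧ x.val m ∉ imageEdges ξ) ∨
      ∃ e : F, H.t e = H.i (z.val 0) ∧ x.val m = (ξ (1 - i)).onE e ∧ y.val m = (ξ i).onE e) ∧
    ∀ k : ℕ, x.val (m + 1 + k) = (ξ i).onE (z.val k) ∧ y.val (m + 1 + k) = (ξ (1 - i)).onE (z.val k)

end Data

/-- Exactly one of three propositions holds. -/
def ExactlyOne (a b c : Prop) : Prop :=
  (a ∧ ¬b ∧ ¬c) ∨ (¬a ∧ b ∧ ¬c) ∨ (¬a ∧ ¬b ∧ c)

/-- The global stable set `{y | d(φⁿ(x), φⁿ(y)) → 0 as n → ∞}`. -/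
def stableSet {X : Type*} (d : X → X → ℝ) (φ : X → X) (x : X) : Set X :=
  {y | Tendsto (fun n : ℕ => d (φ^[n] x) (φ^[n] y)) atTop (𝓝 0)}

end XiFactor

end

/-!
Write `T = ℝ / ℤ` and read `θ` as a `T`-valued function, so that `θ(x)` is the binary expansion
`∑ ε(x_j) 2^{-j}` up to the first edge outside `ξ(H¹)`. The relation `∼_ξ` is the ambiguity
`0111… = 1000…` of binary expansions, together with the identification of the end points `0` and
`1`: `x ∼_ξ y` if and only if, for every `n`, the `n`-th edges of `x` and `y` agree in `G_ξ` and
`θ(σⁿ x) = θ(σⁿ y)`. Unfolding the recursion for `λ_k` gives a series over the edges outside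
`ξ(H¹)`, which makes sense for `κ(x) = ∞` as well and is continuous; primitivity, (H2) and
`X_H ≠ ∅` make the pairs with `κ(x) = κ(y) < ∞` dense, so that `d_{G_ξ}` plus this series is the
extension `d`.

If `π_ξ(x) = π_ξ(y)` and `x_m ≠ y_m`, then all later edges of `x` and `y` are exchanged by `ξ^i`
and `ξ^{1-i}`, with a single `i`. Whether such `m` are bounded below separates the two kinds of
non-trivial fibres. The same dichotomy, eventually equal or eventually exchanged, gives
`s`-bijectivity: a point that is asymptotic to `π_ξ(x)` has a representative that is eventually
equal to `x` or eventually exchanged with it, and in the second case the other point of its fibre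
is eventually equal to `x`.
-/

namespace XiFactor

section PathMetric

theorem hasSum_inv_two_pow_succ : HasSum (fun k : ℕ => (2 : ℝ)⁻¹ ^ (k + 1)) 1 := by
  simpa only [one_div, div_eq_mul_inv, inv_pow, pow_succ, mul_inv, mul_comm, one_mul] using
    hasSum_geometric_two' (1 : ℝ)

section InfInvTwoPow

variable {P : ℕ → Prop} {N : ℕ}

theorem sInf_inv_two_pow_nonneg : 0 ≤ sInf {r : ℝ | ∃ n : ℕ, r = (2 : ℝ)⁻¹ ^ n ∧ P n} :=
  Real.sInf_nonneg fun _ ⟨_, hr, _⟩ => hr ▸ by positivity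

theorem sInf_inv_two_pow_le (h : P N) :
    sInf {r : ℝ | ∃ n : ℕ, r = (2 : ℝ)⁻¹ ^ n ∧ P n} ≤ (2 : ℝ)⁻¹ ^ N :=
  csInf_le ⟨0, fun _ ⟨_, hr, _⟩ => hr ▸ by positivity⟩ ⟨N, rfl, h⟩

theorem exists_gt_of_sInf_inv_two_pow_lt (h0 : P 0)
    (h : sInf {r : ℝ | ∃ n : ℕ, r = (2 : ℝ)⁻¹ ^ n ∧ P n} < (2 : ℝ)⁻¹ ^ N) :
    ∃ n, N < n ∧ P n := by
  obtain ⟨_, ⟨n, rfl, hn⟩, hlt⟩ := exists_lt_of_csInf_lt (by exact ⟨1, 0, (pow_zero _).symm, h0⟩) h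
  exact ⟨n, (pow_lt_pow_iff_right_of_lt_one₀ (by norm_num) (by norm_num)).1 hlt, hn⟩

end InfInvTwoPow

variable {V E : Type*} {G : EdgeGraph V E} {N : ℕ} {x x' y : OneSided G}

/-- Two one-sided paths agree in their first `N` entries. -/
def Agree (N : ℕ) (x y : OneSided G) : Prop := ∀ k, k < N → x.val k = y.val k

theorem Agree.symm (h : Agree N x y) : Agree N y x := fun k hk => (h k hk).symm

theorem Agree.mono {n : ℕ} (h : Agree N x y) (hn : n ≤ N) : Agree n x y :=
  fun k hk => h k (hk.trans_le hn)

theorem iterate_shiftPos_val (n : ℕ) (x : OneSided G) (k : ℕ) :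
    (shiftPos^[n] x).val k = x.val (k + n) := by
  induction n generalizing x with
  | zero => rfl
  | succ n ih => rw [Function.iterate_succ_apply, ih]; rfl

theorem Agree.iterate_shiftPos {n : ℕ} (h : Agree N x y) :
    Agree (N - n) (shiftPos^[n] x) (shiftPos^[n] y) := fun k hk => by
  rw [iterate_shiftPos_val, iterate_shiftPos_val]
  exact h _ (by omega)

theorem dPos_nonneg (x y : OneSided G) : 0 ≤ dPos x y := sInf_inv_two_pow_nonneg

theorem agree_of_dPos_lt (h : dPos x y < (2 : ℝ)⁻¹ ^ N) : Agree (N + 1) x y := by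
  obtain ⟨n, hn, hxy⟩ :=
    exists_gt_of_sInf_inv_two_pow_lt (fun _ hk => absurd hk (Nat.not_lt_zero _)) h
  exact fun k hk => hxy k (by omega)

theorem dPos_comm (x y : OneSided G) : dPos x y = dPos y x := by
  simp only [dPos, eq_comm]

theorem dPos_self (x : OneSided G) : dPos x x = 0 :=
  le_antisymm (ge_of_tendsto' (tendsto_pow_atTop_nhds_zero_of_lt_one (by norm_num) (by norm_num))
    fun _ => sInf_inv_two_pow_le fun _ _ => rfl) (dPos_nonneg x x)

theorem Agree.dPos_le (h : Agree N x x') : dPos x' y ≤ dPos x y + (2 : ℝ)⁻¹ ^ N := by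
  rw [← sub_le_iff_le_add]
  refine le_csInf ⟨1, 0, (pow_zero _).symm, fun k hk => absurd hk (Nat.not_lt_zero k)⟩ ?_
  rintro _ ⟨n, rfl, hn⟩
  have hmin : dPos x' y ≤ (2 : ℝ)⁻¹ ^ min n N := sInf_inv_two_pow_le fun k hk =>
    (h k (hk.trans_le (min_le_right _ _))).symm.trans (hn k (hk.trans_le (min_le_left _ _)))
  have hsum : (2 : ℝ)⁻¹ ^ min n N ≤ (2 : ℝ)⁻¹ ^ n + (2 : ℝ)⁻¹ ^ N := by
    rcases min_choice n N with h | h <;> rw [h] <;> simp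
  linarith

theorem mem_nhds_oneSided {s : Set (OneSided G)} :
    s ∈ 𝓝 x ↔ ∃ N, ∀ y, Agree N x y → y ∈ s := by
  let _ : TopologicalSpace E := ⊥
  have : DiscreteTopology E := ⟨rfl⟩
  have hn : 𝓝 x = Filter.comap (fun x : OneSided G => x.val) (𝓝 x.val) := nhds_induced _ _
  rw [hn, nhds_pi]
  constructor
  · rintro ⟨t, ht, hts⟩
    obtain ⟨I, hI, u, hu, hut⟩ := Filter.mem_pi.1 ht
    obtain ⟨N, hN⟩ := hI.bddAbove
    refine ⟨N + 1, fun y hy => hts (hut fun i hi => ?_)⟩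
    have hxi := mem_of_mem_nhds (hu i)
    rwa [hy i (Nat.lt_succ_of_le (hN hi))] at hxi
  · rintro ⟨N, hN⟩
    exact ⟨(Iio N).pi fun i => {x.val i}, Filter.pi_mem_pi (finite_Iio N) fun i _ => by simp,
      fun y hy => hN y fun k hk => (hy k hk).symm⟩

end PathMetric

section Circle

theorem exp_two_pi_I_eq_toCircle (s : ℝ) :
    Complex.exp (2 * Real.pi * Complex.I * (s : ℂ)) =
      (AddCircle.toCircle (s : UnitAddCircle) : ℂ) := by
  rw [AddCircle.toCircle_apply_mk, Circle.coe_exp]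
  congr 1
  push_cast
  ring

theorem exists_coe_eq_and_abs_eq_norm (u : UnitAddCircle) :
    ∃ t : ℝ, (t : UnitAddCircle) = u ∧ |t| = ‖u‖ := by
  induction u using QuotientAddGroup.induction_on with
  | H x => exact ⟨x - round x, by simp, UnitAddCircle.norm_eq.symm⟩

theorem dCircle_toCircle (a b : UnitAddCircle) : dCircle a.toCircle b.toCircle = dist a b := by
  have hset (s : ℝ) : Complex.exp (2 * Real.pi * Complex.I * (s : ℂ)) * a.toCircle = b.toCircle ↔
      (s : UnitAddCircle) = b - a := by
    rw [exp_two_pi_I_eq_toCircle, ← Circle.coe_mul, Circle.coe_inj, ← AddCircle.toCircle_add,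
      (AddCircle.injective_toCircle one_ne_zero).eq_iff, eq_sub_iff_add_eq]
  obtain ⟨t, ht, hnorm⟩ := exists_coe_eq_and_abs_eq_norm (b - a)
  simp only [dCircle, hset]
  rw [dist_comm, dist_eq_norm, ← hnorm]
  refine IsLeast.csInf_eq ⟨⟨t, rfl, ht⟩, ?_⟩
  rintro _ ⟨s, rfl, hs⟩
  rw [hnorm, ← hs, UnitAddCircle.norm_eq]
  simpa using round_le s 0

theorem unitAddCircle_dist_le_half (a b : UnitAddCircle) : dist a b ≤ 1 / 2 := by
  rw [dist_eq_norm]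
  simpa using AddCircle.norm_le_half_period (1 : ℝ) (x := a - b) one_ne_zero

theorem unitAddCircle_dist_coe_le (s t : ℝ) :
    dist (s : UnitAddCircle) (t : UnitAddCircle) ≤ |s - t| := by
  rw [dist_eq_norm, ← AddCircle.coe_sub, UnitAddCircle.norm_eq]
  simpa using round_le (s - t) 0

theorem coe_unitAddCircle_ne_of_abs_sub_eq_half {s t : ℝ} (h : |s - t| = 1 / 2) :
    (s : UnitAddCircle) ≠ t := fun hst => by
  have hnorm := (AddCircle.norm_coe_eq_abs_iff (1 : ℝ) (x := s - t) one_ne_zero).2 (by simp [h])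
  rw [AddCircle.coe_sub, hst, sub_self, norm_zero, h] at hnorm
  norm_num at hnorm

theorem eq_zero_and_eq_one_or_of_coe_unitAddCircle_eq {s t : ℝ} (hs : s ∈ Icc 0 1)
    (ht : t ∈ Icc 0 1) (h : (s : UnitAddCircle) = t) (hne : s ≠ t) :
    s = 0 ∧ t = 1 ∨ s = 1 ∧ t = 0 := by
  obtain ⟨n, hn⟩ : ∃ n : ℤ, n • (1 : ℝ) = s - t := by
    rwa [← AddCircle.coe_eq_zero_iff, AddCircle.coe_sub, sub_eq_zero]
  rw [zsmul_one] at hn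
  have hlo : -1 ≤ n := by exact_mod_cast (show (-1 : ℝ) ≤ n by linarith [hs.1, ht.2])
  have hhi : n ≤ 1 := by exact_mod_cast (show (n : ℝ) ≤ 1 by linarith [hs.2, ht.1])
  interval_cases n <;> push_cast at hn
  · exact Or.inl ⟨by linarith [hs.1, ht.2], by linarith [hs.1, ht.2]⟩
  · exact absurd (sub_eq_zero.1 hn.symm) hne
  · exact Or.inr ⟨by linarith [hs.2, ht.1], by linarith [hs.2, ht.1]⟩

theorem eq_of_two_nsmul_eq {a b : UnitAddCircle} (h : 2 • a = 2 • b) (hd : dist a b < 1 / 2) :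
    a = b := by
  by_contra hab
  have htwo : 2 • (a - b) = 0 := by rw [smul_sub, h, sub_self]
  have hle := AddCircle.le_add_order_smul_norm_of_isOfFinAddOrder (p := 1)
    (isOfFinAddOrder_iff_nsmul_eq_zero.2 ⟨2, two_pos, htwo⟩) (sub_ne_zero.2 hab)
  have horder : addOrderOf (a - b) ≤ 2 := addOrderOf_le_of_nsmul_eq_zero two_pos htwo
  rw [dist_eq_norm] at hd
  have := nsmul_le_nsmul_left (norm_nonneg (a - b)) horder
  rw [two_nsmul] at this
  linarith

theorem dist_two_nsmul {a b : UnitAddCircle} (hd : dist a b ≤ 1 / 4) :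
    dist (2 • a) (2 • b) = 2 * dist a b := by
  obtain ⟨t, ht, hnorm⟩ := exists_coe_eq_and_abs_eq_norm (a - b)
  rw [dist_eq_norm, ← hnorm] at hd
  rw [dist_eq_norm, dist_eq_norm, ← smul_sub, ← hnorm, ← ht, ← AddCircle.coe_nsmul,
    (AddCircle.norm_coe_eq_abs_iff (1 : ℝ) one_ne_zero).2]
  · simp [abs_mul]
  · simp only [nsmul_eq_mul, Nat.cast_ofNat, abs_mul, Nat.abs_ofNat, abs_one]
    linarith

end Circle

section Edges

theorem fin_two_one_sub_ne (i : Fin 2) : 1 - i ≠ i := by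
  revert i; decide

theorem fin_two_eq_one_sub_of_ne {i j : Fin 2} : j ≠ i → j = 1 - i := by
  revert i j; decide

variable {W F V E : Type*} {H : EdgeGraph W F} {G : EdgeGraph V E} (ξ : Fin 2 → Embedding H G)

/-- The map `(i, y) ↦ ξ^i(y)`. Hypothesis (H1) amounts to its injectivity. -/
def edgeMap (p : Fin 2 × F) : E := (ξ p.1).onE p.2

/-- The involution of the edges of `G` that exchanges `ξ⁰(y)` and `ξ¹(y)` for each edge `y` of `H`
and fixes all other edges. -/
noncomputable def swapEdge : E → E :=
  Function.extend (edgeMap ξ) (fun p => edgeMap ξ (1 - p.1, p.2)) id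

/-- The class of an edge of `G` as an edge of `G_ξ`. -/
def edgeClass (e : E) : QuotEdge ξ := Quot.mk _ e

/-- `(e, e') = (ξ^i(y), ξ^{1-i}(y))` for an edge `y` of `H`. -/
def Flipped (i : Fin 2) (e e' : E) : Prop := ∃ y, e = (ξ i).onE y ∧ e' = (ξ (1 - i)).onE y

variable {ξ} {i j : Fin 2} {e e' : E}

theorem edgeMap_injective (h1 : range (ξ 0).onE ∩ range (ξ 1).onE = ∅) :
    Function.Injective (edgeMap ξ) := by
  have hne (y y' : F) : (ξ 0).onE y ≠ (ξ 1).onE y' := fun h =>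
    h1.le ⟨mem_range_self y, h ▸ mem_range_self y'⟩
  rintro ⟨i, y⟩ ⟨j, y'⟩ h
  fin_cases i <;> fin_cases j
  · exact congrArg (Prod.mk 0) ((ξ 0).injE h)
  · exact absurd h (hne y y')
  · exact absurd h.symm (hne y' y)
  · exact congrArg (Prod.mk 1) ((ξ 1).injE h)

theorem onE_mem_imageEdges (i : Fin 2) (y : F) : (ξ i).onE y ∈ imageEdges ξ := by
  fin_cases i
  · exact Or.inl (mem_range_self y)
  · exact Or.inr (mem_range_self y)

theorem Flipped.symm (h : Flipped ξ i e e') : Flipped ξ (1 - i) e' e := by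
  obtain ⟨y, he, he'⟩ := h
  exact ⟨y, he', by rwa [sub_sub_cancel]⟩

theorem Flipped.mem (h : Flipped ξ i e e') : e ∈ imageEdges ξ := by
  obtain ⟨y, rfl, -⟩ := h
  exact onE_mem_imageEdges i y

theorem Flipped.ne (hinj : Function.Injective (edgeMap ξ)) (h : Flipped ξ i e e') : e ≠ e' := by
  obtain ⟨y, rfl, rfl⟩ := h
  exact fun h => fin_two_one_sub_ne i (congrArg Prod.fst (@hinj (i, y) (1 - i, y) h)).symm

theorem Flipped.index_eq (hinj : Function.Injective (edgeMap ξ)) (hi : Flipped ξ i e e')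
    (hj : Flipped ξ j e e') : i = j := by
  obtain ⟨y, rfl, -⟩ := hi
  obtain ⟨z, h, -⟩ := hj
  exact congrArg Prod.fst (@hinj (i, y) (j, z) h)

theorem Flipped.edgeClass_eq (h : Flipped ξ i e e') : edgeClass ξ e = edgeClass ξ e' := by
  obtain ⟨y, rfl, rfl⟩ := h
  fin_cases i
  · exact Quot.sound ⟨y, rfl, rfl⟩
  · exact (Quot.sound ⟨y, rfl, rfl⟩ : edgeClass ξ ((ξ 0).onE y) = edgeClass ξ ((ξ 1).onE y)).symm

theorem exists_flipped_of_mem (he : e ∈ imageEdges ξ) : ∃ i e', Flipped ξ i e e' := by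
  rcases he with ⟨y, rfl⟩ | ⟨y, rfl⟩
  · exact ⟨0, _, y, rfl, rfl⟩
  · exact ⟨1, _, y, rfl, rfl⟩

theorem Flipped.eq_swapEdge (hinj : Function.Injective (edgeMap ξ)) (h : Flipped ξ i e e') :
    e' = swapEdge ξ e := by
  obtain ⟨y, rfl, rfl⟩ := h
  exact (hinj.extend_apply (fun p => edgeMap ξ (1 - p.1, p.2)) id (i, y)).symm

theorem swapEdge_of_notMem (he : e ∉ imageEdges ξ) : swapEdge ξ e = e :=
  Function.extend_apply' _ _ _ fun ⟨⟨i, y⟩, h⟩ => he (h ▸ onE_mem_imageEdges i y)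

theorem edgeClass_eq_iff (hinj : Function.Injective (edgeMap ξ)) :
    edgeClass ξ e = edgeClass ξ e' ↔ e = e' ∨ ∃ i, Flipped ξ i e e' := by
  refine ⟨fun h => ?_, ?_⟩
  · let pair : QuotEdge ξ → Set E := Quot.lift (fun e => {e, swapEdge ξ e}) (by
      rintro _ _ ⟨y, rfl, rfl⟩
      rw [← Flipped.eq_swapEdge (i := 0) hinj ⟨y, rfl, rfl⟩,
        ← Flipped.eq_swapEdge (i := 1) hinj ⟨y, rfl, rfl⟩]
      exact Set.pair_comm _ _)
    have hmem : e' = e ∨ e' = swapEdge ξ e :=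
      (h ▸ mem_insert e' _ : e' ∈ pair (edgeClass ξ e))
    by_cases he : e ∈ imageEdges ξ
    · obtain ⟨i, f, hf⟩ := exists_flipped_of_mem he
      obtain rfl := hf.eq_swapEdge hinj
      exact hmem.imp Eq.symm fun h : e' = _ => ⟨i, h ▸ hf⟩
    · exact Or.inl (hmem.elim Eq.symm fun h => (h.trans (swapEdge_of_notMem he)).symm)
  · rintro (rfl | ⟨i, h⟩)
    exacts [rfl, h.edgeClass_eq]

theorem flipped_of_edgeClass_eq_of_ne (hinj : Function.Injective (edgeMap ξ))
    (h : edgeClass ξ e = edgeClass ξ e') (hne : e ≠ e') : ∃ i, Flipped ξ i e e' :=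
  ((edgeClass_eq_iff hinj).1 h).resolve_left hne

theorem mem_imageEdges_iff_of_edgeClass_eq (hinj : Function.Injective (edgeMap ξ))
    (h : edgeClass ξ e = edgeClass ξ e') : e ∈ imageEdges ξ ↔ e' ∈ imageEdges ξ := by
  rcases (edgeClass_eq_iff hinj).1 h with rfl | ⟨i, h⟩
  exacts [Iff.rfl, iff_of_true h.mem h.symm.mem]

theorem Flipped.eps_eq (hinj : Function.Injective (edgeMap ξ)) (h : Flipped ξ i e e') :
    eps ξ e = (i : ℕ) := by
  obtain ⟨y, rfl, -⟩ := h
  fin_cases i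
  · exact (if_neg fun ⟨z, hz⟩ => one_ne_zero (congrArg Prod.fst (@hinj (1, z) (0, y) hz))).trans
      Nat.cast_zero.symm
  · exact (if_pos (mem_range_self y)).trans Nat.cast_one.symm

theorem Flipped.abs_eps_sub_eps (hinj : Function.Injective (edgeMap ξ)) (h : Flipped ξ i e e') :
    |eps ξ e - eps ξ e'| = 1 := by
  rw [h.eps_eq hinj, h.symm.eps_eq hinj]
  fin_cases i <;> simp

variable (ξ)

theorem eps_eq_zero_or_one (e : E) : eps ξ e = 0 ∨ eps ξ e = 1 := by
  unfold eps
  split_ifs <;> simp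

theorem eps_nonneg (e : E) : 0 ≤ eps ξ e := by
  rcases eps_eq_zero_or_one ξ e with h | h <;> norm_num [h]

theorem eps_le_one (e : E) : eps ξ e ≤ 1 := by
  rcases eps_eq_zero_or_one ξ e with h | h <;> norm_num [h]

end Edges

section Code

variable {W F V E : Type*} {H : EdgeGraph W F} {G : EdgeGraph V E} {ξ : Fin 2 → Embedding H G}
  {x y : OneSided G} {n N : ℕ}

variable (ξ) in
/-- The first entry of `x` outside `ξ(H¹)` is `x.val n`, that is, `n(x) = n + 1`. -/
def FirstExit (x : OneSided G) (n : ℕ) : Prop :=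
  x.val n ∉ imageEdges ξ ∧ ∀ k < n, x.val k ∈ imageEdges ξ

theorem kappa_eq_zero_iff : kappa ξ x = 0 ↔ ∀ n, x.val n ∈ imageEdges ξ := by
  simp [kappa, Set.encard_eq_zero, Set.eq_empty_iff_forall_notMem]

theorem FirstExit.kappa_ne_zero (h : FirstExit ξ x n) : kappa ξ x ≠ 0 :=
  fun h0 => h.1 (kappa_eq_zero_iff.1 h0 n)

theorem FirstExit.firstOut_eq (h : FirstExit ξ x n) : firstOut ξ x = n + 1 := by
  have hleast : IsLeast {n : ℕ | x.val n ∉ imageEdges ξ} n :=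
    ⟨h.1, fun k hk => not_lt.1 fun hkn => hk (h.2 k hkn)⟩
  rw [firstOut, hleast.csInf_eq]

theorem FirstExit.of_agree (h : FirstExit ξ x n) (hxy : Agree (n + 1) x y) : FirstExit ξ y n :=
  ⟨hxy n (by omega) ▸ h.1, fun k hk => hxy k (by omega) ▸ h.2 k hk⟩

theorem exists_firstExit_le (h : x.val N ∉ imageEdges ξ) : ∃ n ≤ N, FirstExit ξ x n := by
  classical
  have hex : ∃ n, x.val n ∉ imageEdges ξ := ⟨N, h⟩
  exact ⟨Nat.find hex, Nat.find_min' hex h, Nat.find_spec hex,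
    fun k hk => not_not.1 (Nat.find_min hex hk)⟩

theorem exists_firstExit (hk : kappa ξ x ≠ 0) : ∃ n, FirstExit ξ x n := by
  obtain ⟨N, hN⟩ := not_forall.1 (mt kappa_eq_zero_iff.2 hk)
  obtain ⟨n, -, h⟩ := exists_firstExit_le hN
  exact ⟨n, h⟩

theorem kappa_of_mem (h : x.val 0 ∈ imageEdges ξ) : kappa ξ x = kappa ξ (shiftPos x) := by
  have hset : {m | x.val m ∉ imageEdges ξ} =
      Nat.succ '' {m | (shiftPos x).val m ∉ imageEdges ξ} := by
    ext m
    cases m with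
    | zero => simp [h]
    | succ m => simp [shiftPos]
  rw [kappa, hset, Nat.succ_injective.encard_image, kappa]

theorem kappa_of_notMem (h : x.val 0 ∉ imageEdges ξ) :
    kappa ξ x = kappa ξ (shiftPos x) + 1 := by
  have hset : {m | x.val m ∉ imageEdges ξ} =
      insert 0 (Nat.succ '' {m | (shiftPos x).val m ∉ imageEdges ξ}) := by
    ext m
    cases m with
    | zero => simp [h]
    | succ m => simp [shiftPos]
  rw [kappa, hset, Set.encard_insert_of_notMem (by simp), Nat.succ_injective.encard_image, kappa]

theorem firstOut_of_mem (h : x.val 0 ∈ imageEdges ξ) (hk : kappa ξ x ≠ 0) :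
    firstOut ξ x = firstOut ξ (shiftPos x) + 1 := by
  obtain ⟨n, hn⟩ := exists_firstExit (kappa_of_mem h ▸ hk)
  have hx : FirstExit ξ x (n + 1) :=
    ⟨hn.1, fun k hk => k.casesOn (fun _ => h) (fun k hk => hn.2 k (by omega)) hk⟩
  rw [hx.firstOut_eq, hn.firstOut_eq]

theorem FirstExit.kappa_eq (h : FirstExit ξ x n) :
    kappa ξ x = kappa ξ (shiftPos^[n + 1] x) + 1 := by
  induction n generalizing x with
  | zero => exact kappa_of_notMem h.1
  | succ n ih =>
    rw [kappa_of_mem (h.2 0 n.succ_pos), Function.iterate_succ_apply]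
    exact ih ⟨h.1, fun k hk => h.2 (k + 1) (Nat.succ_lt_succ hk)⟩

variable (ξ) in
/-- The path that remains after the first entry outside `ξ(H¹)`. -/
noncomputable def afterOut (x : OneSided G) : OneSided G := shiftPos^[firstOut ξ x] x

theorem kappa_eq_kappa_afterOut_add_one (hk : kappa ξ x ≠ 0) :
    kappa ξ x = kappa ξ (afterOut ξ x) + 1 := by
  obtain ⟨n, hn⟩ := exists_firstExit hk
  rw [hn.kappa_eq, afterOut, hn.firstOut_eq]

variable (ξ) in
/-- `2^{-n(x)}`, understood as `0` if `n(x) = ∞`. -/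
noncomputable def invOut (x : OneSided G) : ℝ :=
  if kappa ξ x = 0 then 0 else (2 : ℝ)⁻¹ ^ firstOut ξ x

theorem FirstExit.invOut_eq (h : FirstExit ξ x n) : invOut ξ x = (2 : ℝ)⁻¹ ^ (n + 1) := by
  rw [invOut, if_neg h.kappa_ne_zero, h.firstOut_eq]

theorem invOut_nonneg (x : OneSided G) : 0 ≤ invOut ξ x := by
  unfold invOut
  split_ifs <;> positivity

theorem invOut_le_of_forall_mem (h : ∀ k < N, x.val k ∈ imageEdges ξ) :
    invOut ξ x ≤ (2 : ℝ)⁻¹ ^ (N + 1) := by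
  by_cases hk : kappa ξ x = 0
  · rw [invOut, if_pos hk]
    positivity
  · obtain ⟨n, hn⟩ := exists_firstExit hk
    rw [hn.invOut_eq]
    exact pow_le_pow_of_le_one (by norm_num) (by norm_num)
      (by by_contra! hlt; exact hn.1 (h n (by omega)))

theorem invOut_le_half (x : OneSided G) : invOut ξ x ≤ 2⁻¹ := by
  simpa using invOut_le_of_forall_mem (N := 0) (x := x) fun k hk => absurd hk (Nat.not_lt_zero k)

theorem invOut_eq_iff (hx : kappa ξ x ≠ 0) (hy : kappa ξ y ≠ 0) :
    invOut ξ x = invOut ξ y ↔ firstOut ξ x = firstOut ξ y := by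
  rw [invOut, invOut, if_neg hx, if_neg hy]
  exact (pow_right_injective₀ (by norm_num : (0 : ℝ) < 2⁻¹) (by norm_num)).eq_iff

theorem summable_eps (x : OneSided G) :
    Summable fun k : ℕ => eps ξ (x.val k) * (2 : ℝ)⁻¹ ^ (k + 1) :=
  hasSum_inv_two_pow_succ.summable.of_nonneg_of_le
    (fun k => mul_nonneg (eps_nonneg ξ _) (by positivity))
    fun k => mul_le_of_le_one_left (by positivity) (eps_le_one ξ _)

variable (ξ) in
/-- The real number `∑ ε(x_j) 2^{-j}`, summed over `1 ≤ j < n(x)`. -/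
noncomputable def digitSum (x : OneSided G) : ℝ :=
  if kappa ξ x = 0 then ∑' k : ℕ, eps ξ (x.val k) * (2 : ℝ)⁻¹ ^ (k + 1)
  else ∑ k ∈ Finset.range (firstOut ξ x - 1), eps ξ (x.val k) * (2 : ℝ)⁻¹ ^ (k + 1)

theorem digitSum_of_notMem (h : x.val 0 ∉ imageEdges ξ) : digitSum ξ x = 0 := by
  have hx : FirstExit ξ x 0 := ⟨h, fun k hk => absurd hk (Nat.not_lt_zero k)⟩
  rw [digitSum, if_neg hx.kappa_ne_zero, hx.firstOut_eq, Nat.add_sub_cancel, Finset.sum_range_zero]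

theorem digitSum_of_mem (h : x.val 0 ∈ imageEdges ξ) :
    digitSum ξ x = (eps ξ (x.val 0) + digitSum ξ (shiftPos x)) / 2 := by
  have hterm (k : ℕ) : eps ξ (x.val (k + 1)) * (2 : ℝ)⁻¹ ^ (k + 1 + 1) =
      eps ξ ((shiftPos x).val k) * (2 : ℝ)⁻¹ ^ (k + 1) / 2 := by
    rw [pow_succ, ← mul_assoc, div_eq_mul_inv, shiftPos]
  rw [digitSum, digitSum, ← kappa_of_mem h]
  split_ifs with hk
  · rw [(summable_eps x).tsum_eq_zero_add]
    simp only [hterm, tsum_div_const]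
    ring
  · rw [firstOut_of_mem h hk, Nat.add_sub_cancel,
      ← Nat.sub_add_cancel (show 1 ≤ firstOut ξ (shiftPos x) from Nat.le_add_left _ _),
      Finset.sum_range_succ', Nat.add_sub_cancel]
    simp only [hterm, ← Finset.sum_div]
    ring

theorem digitSum_nonneg (x : OneSided G) : 0 ≤ digitSum ξ x := by
  have hterm (k : ℕ) : 0 ≤ eps ξ (x.val k) * (2 : ℝ)⁻¹ ^ (k + 1) :=
    mul_nonneg (eps_nonneg ξ _) (by positivity)
  unfold digitSum
  split_ifs
  exacts [tsum_nonneg hterm, Finset.sum_nonneg fun k _ => hterm k]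

theorem digitSum_le_one (x : OneSided G) : digitSum ξ x ≤ 1 := by
  have hterm (k : ℕ) : eps ξ (x.val k) * (2 : ℝ)⁻¹ ^ (k + 1) ≤ (2 : ℝ)⁻¹ ^ (k + 1) :=
    mul_le_of_le_one_left (by positivity) (eps_le_one ξ _)
  have hsum := hasSum_inv_two_pow_succ
  unfold digitSum
  split_ifs
  · exact ((summable_eps x).tsum_le_tsum hterm hsum.summable).trans_eq hsum.tsum_eq
  · exact (Finset.sum_le_sum fun k _ => hterm k).trans
      (sum_le_hasSum _ (fun k _ => by positivity) hsum)

theorem Agree.digitSum_eq (h : Agree n x y)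
    (hn : digitSum ξ (shiftPos^[n] x) = digitSum ξ (shiftPos^[n] y)) :
    digitSum ξ x = digitSum ξ y := by
  induction n generalizing x y with
  | zero => exact hn
  | succ n ih =>
    have h0 : x.val 0 = y.val 0 := h 0 (by omega)
    by_cases hx : x.val 0 ∈ imageEdges ξ
    · have hy : y.val 0 ∈ imageEdges ξ := h0 ▸ hx
      have hs : digitSum ξ (shiftPos x) = digitSum ξ (shiftPos y) :=
        ih (h.iterate_shiftPos (n := 1)) hn
      rw [digitSum_of_mem hx, digitSum_of_mem hy, h0, hs]
    · rw [digitSum_of_notMem hx, digitSum_of_notMem (h0 ▸ hx)]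

theorem Agree.abs_digitSum_sub_le (h : Agree N x y) :
    |digitSum ξ x - digitSum ξ y| ≤ (2 : ℝ)⁻¹ ^ N := by
  induction N generalizing x y with
  | zero =>
    rw [pow_zero, abs_le]
    constructor <;>
      linarith [digitSum_nonneg (ξ := ξ) x, digitSum_nonneg (ξ := ξ) y,
        digitSum_le_one (ξ := ξ) x, digitSum_le_one (ξ := ξ) y]
  | succ N ih =>
    have h0 : x.val 0 = y.val 0 := h 0 (by omega)
    by_cases hx : x.val 0 ∈ imageEdges ξ
    · have hy : y.val 0 ∈ imageEdges ξ := h0 ▸ hx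
      rw [digitSum_of_mem hx, digitSum_of_mem hy, h0, ← sub_div, add_sub_add_left_eq_sub,
        abs_div, abs_two, pow_succ, ← div_eq_mul_inv]
      exact div_le_div_of_nonneg_right (ih (h.iterate_shiftPos (n := 1))) two_pos.le
    · rw [digitSum_of_notMem hx, digitSum_of_notMem (h0 ▸ hx), sub_self, abs_zero]
      positivity

variable (ξ) in
/-- The angle of `θ(x)`, as a point of `ℝ/ℤ`. -/
noncomputable def angle (x : OneSided G) : UnitAddCircle := (digitSum ξ x : UnitAddCircle)

theorem theta_eq_toCircle_angle (x : OneSided G) :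
    theta ξ x = (AddCircle.toCircle (angle ξ x) : ℂ) := by
  rw [angle, ← exp_two_pi_I_eq_toCircle, theta, digitSum]
  split_ifs <;> rfl

theorem theta_eq_iff : theta ξ x = theta ξ y ↔ angle ξ x = angle ξ y := by
  rw [theta_eq_toCircle_angle, theta_eq_toCircle_angle, Circle.coe_inj,
    (AddCircle.injective_toCircle one_ne_zero).eq_iff]

theorem angle_of_notMem (h : x.val 0 ∉ imageEdges ξ) : angle ξ x = 0 := by
  rw [angle, digitSum_of_notMem h, AddCircle.coe_zero]

theorem two_nsmul_angle (h : x.val 0 ∈ imageEdges ξ) : 2 • angle ξ x = angle ξ (shiftPos x) := by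
  have h2 : 2 • digitSum ξ x = eps ξ (x.val 0) + digitSum ξ (shiftPos x) := by
    rw [digitSum_of_mem h, two_nsmul, add_halves]
  rw [angle, angle, ← AddCircle.coe_nsmul, h2, AddCircle.coe_add]
  rcases eps_eq_zero_or_one ξ (x.val 0) with h | h <;> simp [h]

theorem Agree.dist_angle_le (h : Agree N x y) :
    dist (angle ξ x) (angle ξ y) ≤ (2 : ℝ)⁻¹ ^ N :=
  (unitAddCircle_dist_coe_le _ _).trans h.abs_digitSum_sub_le

end Code

section PathCode

variable {W F V E : Type*} {H : EdgeGraph W F} {G : EdgeGraph V E} {ξ : Fin 2 → Embedding H G}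
  {x y : OneSided G} {i : Fin 2}

variable (ξ) in
/-- The code of a path: its image in `G_ξ` together with the angles of all its shifts. It
separates exactly the classes of `∼_ξ`. -/
noncomputable def code (x : OneSided G) (n : ℕ) : QuotEdge ξ × UnitAddCircle :=
  (edgeClass ξ (x.val n), angle ξ (shiftPos^[n] x))

theorem edgeClass_eq_of_code_eq (h : code ξ x = code ξ y) (n : ℕ) :
    edgeClass ξ (x.val n) = edgeClass ξ (y.val n) :=
  congrArg Prod.fst (congrFun h n)

theorem angle_eq_of_code_eq (h : code ξ x = code ξ y) : angle ξ x = angle ξ y :=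
  congrArg Prod.snd (congrFun h 0)

theorem code_iterate_shiftPos (m : ℕ) (x : OneSided G) :
    code ξ (shiftPos^[m] x) = fun n => code ξ x (n + m) := by
  funext n
  rw [code, code, iterate_shiftPos_val, Function.iterate_add_apply]

theorem code_iterate_shiftPos_eq (h : code ξ x = code ξ y) (m : ℕ) :
    code ξ (shiftPos^[m] x) = code ξ (shiftPos^[m] y) := by
  rw [code_iterate_shiftPos, code_iterate_shiftPos, h]

theorem code_eq_of_shiftPos_of_dist_lt (hinj : Function.Injective (edgeMap ξ))
    (h : code ξ (shiftPos x) = code ξ (shiftPos y))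
    (h0 : edgeClass ξ (x.val 0) = edgeClass ξ (y.val 0))
    (hd : dist (angle ξ x) (angle ξ y) < 1 / 2) : code ξ x = code ξ y := by
  have hiff := mem_imageEdges_iff_of_edgeClass_eq hinj h0
  have hangle : angle ξ x = angle ξ y := by
    by_cases hx : x.val 0 ∈ imageEdges ξ
    · refine eq_of_two_nsmul_eq ?_ hd
      rw [two_nsmul_angle hx, two_nsmul_angle (hiff.1 hx), angle_eq_of_code_eq h]
    · rw [angle_of_notMem hx, angle_of_notMem (hiff.not.1 hx)]
  funext n
  exact n.casesOn (Prod.ext h0 hangle) (congrFun h)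

theorem dist_angle_le_half_pow (hinj : Function.Injective (edgeMap ξ))
    (h : ∀ n, edgeClass ξ (x.val n) = edgeClass ξ (y.val n))
    (hd : ∀ n, dist (angle ξ (shiftPos^[n] x)) (angle ξ (shiftPos^[n] y)) ≤ 1 / 4) (N : ℕ) :
    dist (angle ξ x) (angle ξ y) ≤ (1 / 2) ^ N := by
  induction N generalizing x y with
  | zero => exact (unitAddCircle_dist_le_half _ _).trans (by norm_num)
  | succ N ih =>
    have hiff := mem_imageEdges_iff_of_edgeClass_eq hinj (h 0)
    by_cases hx : x.val 0 ∈ imageEdges ξ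
    · have hdouble := dist_two_nsmul (hd 0)
      rw [Function.iterate_zero_apply, Function.iterate_zero_apply, two_nsmul_angle hx,
        two_nsmul_angle (hiff.1 hx)] at hdouble
      have := ih (x := shiftPos x) (y := shiftPos y) (fun n => h (n + 1)) fun n => hd (n + 1)
      rw [pow_succ]
      linarith
    · rw [angle_of_notMem hx, angle_of_notMem (hiff.not.1 hx), dist_self]
      positivity

-- Expansiveness: the shift doubles every angle that it does not reset.
theorem code_eq_of_dist_angle_le (hinj : Function.Injective (edgeMap ξ))
    (h : ∀ n, edgeClass ξ (x.val n) = edgeClass ξ (y.val n))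
    (hd : ∀ n, dist (angle ξ (shiftPos^[n] x)) (angle ξ (shiftPos^[n] y)) ≤ 1 / 4) :
    code ξ x = code ξ y := by
  refine funext fun n => Prod.ext (h n) (dist_le_zero.1 (ge_of_tendsto'
    (tendsto_pow_atTop_nhds_zero_of_lt_one (by norm_num) (by norm_num))
    (dist_angle_le_half_pow hinj (fun k => ?_) fun k => ?_)))
  · simpa only [iterate_shiftPos_val] using h (k + n)
  · simpa only [Function.iterate_add_apply] using hd (k + n)

theorem digitSum_of_forall_flipped (hinj : Function.Injective (edgeMap ξ))
    (h : ∀ k, Flipped ξ i (x.val k) (y.val k)) : digitSum ξ x = (i : ℕ) := by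
  rw [digitSum, if_pos (kappa_eq_zero_iff.2 fun n => (h n).mem)]
  simp only [(h _).eps_eq hinj, tsum_mul_left, hasSum_inv_two_pow_succ.tsum_eq, mul_one]

theorem flipped_zero_and_digitSum_shiftPos (hinj : Function.Injective (edgeMap ξ))
    (h0 : edgeClass ξ (x.val 0) = edgeClass ξ (y.val 0)) (hx : digitSum ξ x = 0)
    (hy : digitSum ξ y = 1) : Flipped ξ 0 (x.val 0) (y.val 0) ∧
      digitSum ξ (shiftPos x) = 0 ∧ digitSum ξ (shiftPos y) = 1 := by
  have hy0 : y.val 0 ∈ imageEdges ξ := by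
    by_contra hy0
    exact one_ne_zero (hy.symm.trans (digitSum_of_notMem hy0))
  rw [digitSum_of_mem ((mem_imageEdges_iff_of_edgeClass_eq hinj h0).2 hy0)] at hx
  rw [digitSum_of_mem hy0] at hy
  have hxs := digitSum_nonneg (ξ := ξ) (shiftPos x)
  have hys := digitSum_le_one (ξ := ξ) (shiftPos y)
  have hxε := eps_nonneg ξ (x.val 0)
  have hyε := eps_le_one ξ (y.val 0)
  have hεx : eps ξ (x.val 0) = 0 := by linarith
  obtain ⟨i, hi⟩ := flipped_of_edgeClass_eq_of_ne hinj h0 fun he => by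
    rw [he] at hεx
    linarith
  rw [hi.eps_eq hinj, Nat.cast_eq_zero, Fin.val_eq_zero_iff] at hεx
  exact ⟨hεx ▸ hi, by linarith, by linarith⟩

theorem flipped_zero_of_digitSum_eq (hinj : Function.Injective (edgeMap ξ))
    (h : ∀ n, edgeClass ξ (x.val n) = edgeClass ξ (y.val n)) (hx : digitSum ξ x = 0)
    (hy : digitSum ξ y = 1) (n : ℕ) : Flipped ξ 0 (x.val n) (y.val n) := by
  obtain ⟨hflip, hxs, hys⟩ := flipped_zero_and_digitSum_shiftPos hinj (h 0) hx hy
  induction n generalizing x y with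
  | zero => exact hflip
  | succ n ih =>
    obtain ⟨hflip', hxs', hys'⟩ := flipped_zero_and_digitSum_shiftPos hinj (h 1) hxs hys
    exact ih (x := shiftPos x) (y := shiftPos y) (fun k => h (k + 1)) hxs hys hflip' hxs' hys'

-- Equal angles with different first digits: the remaining digits are `000…` and `111…`.
theorem exists_forall_flipped_succ (hinj : Function.Injective (edgeMap ξ))
    (h : code ξ x = code ξ y) (hne : x.val 0 ≠ y.val 0) :
    ∃ i, ∀ k, Flipped ξ i (x.val (k + 1)) (y.val (k + 1)) := by
  have hclass := edgeClass_eq_of_code_eq h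
  obtain ⟨j, hj⟩ := flipped_of_edgeClass_eq_of_ne hinj (hclass 0) hne
  have hangle : (digitSum ξ x : UnitAddCircle) = digitSum ξ y := angle_eq_of_code_eq h
  have hshift : (digitSum ξ (shiftPos x) : UnitAddCircle) = digitSum ξ (shiftPos y) :=
    angle_eq_of_code_eq (code_iterate_shiftPos_eq h 1)
  have hshift_ne : digitSum ξ (shiftPos x) ≠ digitSum ξ (shiftPos y) := fun hs => by
    refine coe_unitAddCircle_ne_of_abs_sub_eq_half ?_ hangle
    rw [digitSum_of_mem hj.mem, digitSum_of_mem hj.symm.mem, hs, ← sub_div,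
      add_sub_add_right_eq_sub, abs_div, abs_two, hj.abs_eps_sub_eps hinj]
  rcases eq_zero_and_eq_one_or_of_coe_unitAddCircle_eq
    ⟨digitSum_nonneg _, digitSum_le_one _⟩ ⟨digitSum_nonneg _, digitSum_le_one _⟩
    hshift hshift_ne with ⟨hx, hy⟩ | ⟨hx, hy⟩
  · exact ⟨0, flipped_zero_of_digitSum_eq hinj (fun k => hclass (k + 1)) hx hy⟩
  · exact ⟨1, fun k =>
      (flipped_zero_of_digitSum_eq hinj (fun k => (hclass (k + 1)).symm) hy hx k).symm⟩

theorem notMem_imageEdges_of_angle_eq (hinj : Function.Injective (edgeMap ξ))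
    (h : angle ξ x = angle ξ y) (h0 : x.val 0 = y.val 0)
    (hflip : ∀ k, Flipped ξ i (x.val (k + 1)) (y.val (k + 1))) : x.val 0 ∉ imageEdges ξ := by
  intro hx
  have hy : y.val 0 ∈ imageEdges ξ := h0 ▸ hx
  have hsx : digitSum ξ (shiftPos x) = (i : ℕ) :=
    digitSum_of_forall_flipped (y := shiftPos y) hinj hflip
  have hsy : digitSum ξ (shiftPos y) = ((1 - i : Fin 2) : ℕ) :=
    digitSum_of_forall_flipped (y := shiftPos x) hinj fun k => (hflip k).symm
  refine coe_unitAddCircle_ne_of_abs_sub_eq_half ?_ h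
  rw [digitSum_of_mem hx, digitSum_of_mem hy, hsx, hsy, h0, ← sub_div,
    add_sub_add_left_eq_sub, abs_div, abs_two]
  fin_cases i <;> simp

theorem flip₁_iff : Flip₁ ξ x y ↔ ∃ (n : ℕ) (i : Fin 2), Agree n x y ∧
    Flipped ξ (1 - i) (x.val n) (y.val n) ∧ ∀ k, n < k → Flipped ξ i (x.val k) (y.val k) := by
  constructor
  · rintro ⟨n, i, z, hagree, hx, hy, hflip⟩
    exact ⟨n, i, hagree, ⟨z n, hx, by rwa [sub_sub_cancel]⟩, fun k hk => ⟨z k, hflip k hk⟩⟩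
  · rintro ⟨n, i, hagree, ⟨e, hx, hy⟩, hflip⟩
    rw [sub_sub_cancel] at hy
    have : Nonempty F := ⟨e⟩
    choose! z hz using hflip
    refine ⟨n, i, Function.update z n e, hagree, ?_, ?_, fun k hk => ?_⟩
    · rwa [Function.update_self]
    · rwa [Function.update_self]
    · rw [Function.update_of_ne hk.ne']
      exact hz k hk

theorem flip₂_iff : Flip₂ ξ x y ↔ ∃ (n : ℕ) (i : Fin 2), Agree n x y ∧
    (∀ k, k + 1 = n → x.val k ∉ imageEdges ξ) ∧ ∀ k, n ≤ k → Flipped ξ i (x.val k) (y.val k) := by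
  constructor
  · rintro ⟨n, i, z, hagree, hout, hflip⟩
    exact ⟨n, i, hagree, hout, fun k hk => ⟨z k, hflip k hk⟩⟩
  · rintro ⟨n, i, hagree, hout, hflip⟩
    have : Nonempty F := let ⟨e, _⟩ := hflip n le_rfl; ⟨e⟩
    choose! z hz using hflip
    exact ⟨n, i, z, hagree, hout, hz⟩

theorem Rel.edgeClass_eq (h : Rel ξ x y) : edgeClass ξ (x.val 0) = edgeClass ξ (y.val 0) := by
  rcases h with rfl | h | h
  · rfl
  · obtain ⟨n, i, hagree, hn, -⟩ := flip₁_iff.1 h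
    rcases n.eq_zero_or_pos with rfl | hpos
    exacts [hn.edgeClass_eq, congrArg _ (hagree 0 hpos)]
  · obtain ⟨n, i, hagree, -, hflip⟩ := flip₂_iff.1 h
    rcases n.eq_zero_or_pos with rfl | hpos
    exacts [(hflip 0 le_rfl).edgeClass_eq, congrArg _ (hagree 0 hpos)]

theorem digitSum_eq_half_of_forall_flipped_succ (hinj : Function.Injective (edgeMap ξ))
    (h0 : Flipped ξ (1 - i) (x.val 0) (y.val 0))
    (h : ∀ k, Flipped ξ i (x.val (k + 1)) (y.val (k + 1))) : digitSum ξ x = 1 / 2 := by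
  have hs : digitSum ξ (shiftPos x) = (i : ℕ) :=
    digitSum_of_forall_flipped (y := shiftPos y) hinj h
  rw [digitSum_of_mem h0.mem, h0.eps_eq hinj, hs]
  fin_cases i <;> simp

theorem angle_eq_zero_of_forall_flipped (hinj : Function.Injective (edgeMap ξ))
    (h : ∀ k, Flipped ξ i (x.val k) (y.val k)) : angle ξ x = 0 := by
  rw [angle, digitSum_of_forall_flipped hinj h]
  match i with
  | 0 => simp
  | 1 => simp

theorem Rel.angle_eq (hinj : Function.Injective (edgeMap ξ)) (h : Rel ξ x y) :
    angle ξ x = angle ξ y := by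
  rcases h with rfl | h | h
  · rfl
  · obtain ⟨n, i, hagree, hn, hflip⟩ := flip₁_iff.1 h
    have hx : digitSum ξ (shiftPos^[n] x) = 1 / 2 :=
      digitSum_eq_half_of_forall_flipped_succ (i := i) (y := shiftPos^[n] y) hinj
        (by simpa only [iterate_shiftPos_val, zero_add] using hn)
        fun k => by simpa only [iterate_shiftPos_val] using hflip (k + 1 + n) (by omega)
    have hy : digitSum ξ (shiftPos^[n] y) = 1 / 2 :=
      digitSum_eq_half_of_forall_flipped_succ (i := 1 - i) (y := shiftPos^[n] x) hinj
        (by simpa only [iterate_shiftPos_val, zero_add] using hn.symm)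
        fun k => by simpa only [iterate_shiftPos_val] using (hflip (k + 1 + n) (by omega)).symm
    rw [angle, angle, hagree.digitSum_eq (hx.trans hy.symm)]
  · obtain ⟨n, i, hagree, hout, hflip⟩ := flip₂_iff.1 h
    cases n with
    | zero =>
      rw [angle_eq_zero_of_forall_flipped hinj fun k => hflip k k.zero_le,
        angle_eq_zero_of_forall_flipped hinj fun k => (hflip k k.zero_le).symm]
    | succ n =>
      have hx : (shiftPos^[n] x).val 0 ∉ imageEdges ξ := by
        simpa only [iterate_shiftPos_val, zero_add] using hout n rfl
      have hxy : (shiftPos^[n] x).val 0 = (shiftPos^[n] y).val 0 := by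
        simpa only [iterate_shiftPos_val, zero_add] using hagree n n.lt_succ_self
      rw [angle, angle, Agree.digitSum_eq (hagree.mono n.le_succ)
        ((digitSum_of_notMem hx).trans (digitSum_of_notMem (hxy ▸ hx)).symm)]

theorem code_eq_of_rel (hinj : Function.Injective (edgeMap ξ)) (h : Rel ξ x y) :
    code ξ x = code ξ y := by
  refine funext fun n => ?_
  induction n generalizing x y with
  | zero => exact Prod.ext h.edgeClass_eq (h.angle_eq hinj)
  | succ _ ih => exact ih (Rel.shift ξ h)

theorem rel_of_code_eq (hinj : Function.Injective (edgeMap ξ)) (h : code ξ x = code ξ y) :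
    Rel ξ x y := by
  classical
  by_cases hex : ∃ n, x.val n ≠ y.val n
  swap
  · exact Or.inl (OneSided.ext (funext fun n => not_not.1 (not_exists.1 hex n)))
  obtain ⟨n, hn, hmin⟩ : ∃ n, x.val n ≠ y.val n ∧ ∀ k < n, x.val k = y.val k :=
    ⟨Nat.find hex, Nat.find_spec hex, fun k hk => not_not.1 (Nat.find_min hex hk)⟩
  obtain ⟨j, hj⟩ := flipped_of_edgeClass_eq_of_ne hinj (edgeClass_eq_of_code_eq h n) hn
  obtain ⟨i, hi⟩ := exists_forall_flipped_succ hinj (code_iterate_shiftPos_eq h n)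
    (by simpa only [iterate_shiftPos_val, zero_add] using hn)
  have hflip (k : ℕ) (hk : n < k) : Flipped ξ i (x.val k) (y.val k) := by
    obtain ⟨l, rfl⟩ := Nat.exists_eq_add_of_lt hk
    simpa only [iterate_shiftPos_val, show l + 1 + n = n + l + 1 by omega] using hi l
  by_cases hji : j = i
  · subst hji
    have hflip' (k : ℕ) (hk : n ≤ k) : Flipped ξ j (x.val k) (y.val k) := by
      rcases hk.eq_or_lt with rfl | hk
      exacts [hj, hflip k hk]
    refine Or.inr (Or.inr (flip₂_iff.2 ⟨n, j, hmin, ?_, hflip'⟩))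
    rintro k rfl
    have hout := notMem_imageEdges_of_angle_eq (i := j) hinj
      (angle_eq_of_code_eq (code_iterate_shiftPos_eq h k))
      (by simpa only [iterate_shiftPos_val, zero_add] using hmin k k.lt_succ_self)
      fun l => by simpa only [iterate_shiftPos_val] using hflip' (l + 1 + k) (by omega)
    simpa only [iterate_shiftPos_val, zero_add] using hout
  · obtain rfl := fin_two_eq_one_sub_of_ne hji
    exact Or.inr (Or.inl (flip₁_iff.2 ⟨n, i, hmin, hj, hflip⟩))

theorem piPos_eq_iff (hinj : Function.Injective (edgeMap ξ)) :
    piPos ξ x = piPos ξ y ↔ code ξ x = code ξ y :=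
  ⟨fun h => congrArg (Quot.lift (code ξ) fun _ _ => code_eq_of_rel hinj) h,
    fun h => Quot.sound (rel_of_code_eq hinj h)⟩

end PathCode

section Lambda

variable {W F V E : Type*} {H : EdgeGraph W F} {G : EdgeGraph V E} {ξ : Fin 2 → Embedding H G}
  {x x' y y' : OneSided G} {N : ℕ}

variable (ξ) in
open Classical in
/-- The contribution to `λ(x, y)` of the `(k + 1)`-st entries outside `ξ(H¹)`. -/
noncomputable def lamTerm : ℕ → OneSided G → OneSided G → ℝ
  | 0, x, y => |invOut ξ x - invOut ξ y| + dist (angle ξ x) (angle ξ y)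
  | k + 1, x, y =>
      if invOut ξ x = invOut ξ y ∧ angle ξ x = angle ξ y then
        invOut ξ x / 4 * lamTerm k (afterOut ξ x) (afterOut ξ y)
      else 0

variable (ξ) in
/-- The common continuous extension of the functions `λ_k` to all pairs of one-sided paths. -/
noncomputable def lamInf (x y : OneSided G) : ℝ := ∑' k, lamTerm ξ k x y

theorem lamTerm_nonneg (k : ℕ) (x y : OneSided G) : 0 ≤ lamTerm ξ k x y := by
  induction k generalizing x y with
  | zero => exact add_nonneg (abs_nonneg _) dist_nonneg
  | succ k ih =>
    unfold lamTerm
    split_ifs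
    · exact mul_nonneg (div_nonneg (invOut_nonneg x) (by norm_num)) (ih _ _)
    · rfl

theorem lamTerm_le (k : ℕ) (x y : OneSided G) : lamTerm ξ k x y ≤ (1 / 2) ^ k := by
  induction k generalizing x y with
  | zero =>
    have hinv : |invOut ξ x - invOut ξ y| ≤ 2⁻¹ :=
      abs_sub_le_of_nonneg_of_le (invOut_nonneg x) (invOut_le_half x) (invOut_nonneg y)
        (invOut_le_half y)
    have hangle := unitAddCircle_dist_le_half (angle ξ x) (angle ξ y)
    rw [lamTerm, pow_zero]
    linarith
  | succ k ih =>
    unfold lamTerm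
    split_ifs
    · rw [pow_succ']
      exact mul_le_mul (by linarith [invOut_le_half (ξ := ξ) x]) (ih _ _) (lamTerm_nonneg _ _ _)
        (by norm_num)
    · positivity

theorem summable_lamTerm (x y : OneSided G) : Summable fun k => lamTerm ξ k x y :=
  summable_geometric_two.of_nonneg_of_le (lamTerm_nonneg · x y) (lamTerm_le · x y)

theorem lamInf_nonneg (x y : OneSided G) : 0 ≤ lamInf ξ x y := tsum_nonneg (lamTerm_nonneg · x y)

theorem lamInf_le_two (x y : OneSided G) : lamInf ξ x y ≤ 2 :=
  ((summable_lamTerm x y).tsum_le_tsum (lamTerm_le · x y) summable_geometric_two).trans_eq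
    tsum_geometric_two

open Classical in
theorem lamInf_eq (x y : OneSided G) :
    lamInf ξ x y = |invOut ξ x - invOut ξ y| + dist (angle ξ x) (angle ξ y) +
      if invOut ξ x = invOut ξ y ∧ angle ξ x = angle ξ y then
        invOut ξ x / 4 * lamInf ξ (afterOut ξ x) (afterOut ξ y)
      else 0 := by
  rw [lamInf, (summable_lamTerm x y).tsum_eq_zero_add]
  simp only [lamTerm]
  split_ifs
  · rw [tsum_mul_left, lamInf]
  · rw [tsum_zero]

theorem abs_invOut_sub_add_dist_angle_le_lamInf (x y : OneSided G) :
    |invOut ξ x - invOut ξ y| + dist (angle ξ x) (angle ξ y) ≤ lamInf ξ x y :=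
  (summable_lamTerm x y).le_tsum 0 fun k _ => lamTerm_nonneg k x y

theorem dist_angle_le_lamInf (x y : OneSided G) :
    dist (angle ξ x) (angle ξ y) ≤ lamInf ξ x y :=
  (le_add_of_nonneg_left (abs_nonneg _)).trans (abs_invOut_sub_add_dist_angle_le_lamInf x y)

theorem lamInf_le (x y : OneSided G) :
    lamInf ξ x y ≤ |invOut ξ x - invOut ξ y| + dist (angle ξ x) (angle ξ y) + invOut ξ x / 2 := by
  rw [lamInf_eq]
  gcongr
  split_ifs
  · calc invOut ξ x / 4 * lamInf ξ (afterOut ξ x) (afterOut ξ y) ≤ invOut ξ x / 4 * 2 :=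
          mul_le_mul_of_nonneg_left (lamInf_le_two _ _)
            (div_nonneg (invOut_nonneg x) (by norm_num))
      _ = invOut ξ x / 2 := by ring
  · exact div_nonneg (invOut_nonneg x) two_pos.le

theorem lamTerm_self (k : ℕ) (x : OneSided G) : lamTerm ξ k x x = 0 := by
  induction k generalizing x with
  | zero => simp [lamTerm]
  | succ k ih => simp [lamTerm, ih]

theorem lamInf_self (x : OneSided G) : lamInf ξ x x = 0 := by
  simp only [lamInf, lamTerm_self, tsum_zero]

theorem lamTerm_comm (k : ℕ) (x y : OneSided G) : lamTerm ξ k x y = lamTerm ξ k y x := by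
  induction k generalizing x y with
  | zero => rw [lamTerm, lamTerm, abs_sub_comm, dist_comm]
  | succ k ih =>
    simp only [lamTerm, ih (afterOut ξ x), eq_comm (a := invOut ξ x), eq_comm (a := angle ξ x)]
    split_ifs with h
    exacts [h.1 ▸ rfl, rfl]

theorem lamInf_comm (x y : OneSided G) : lamInf ξ x y = lamInf ξ y x := by
  simp only [lamInf, lamTerm_comm _ x y]

theorem FirstExit.angle_eq_of_agree {n : ℕ} (h : FirstExit ξ x n) (hxy : Agree (n + 1) x y) :
    angle ξ x = angle ξ y := by
  have hx : (shiftPos^[n] x).val 0 ∉ imageEdges ξ := by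
    simpa only [iterate_shiftPos_val, zero_add] using h.1
  have hy : (shiftPos^[n] y).val 0 ∉ imageEdges ξ := by
    simpa only [iterate_shiftPos_val, zero_add] using (h.of_agree hxy).1
  rw [angle, angle, Agree.digitSum_eq (hxy.mono n.le_succ)
    ((digitSum_of_notMem hx).trans (digitSum_of_notMem hy).symm)]

theorem Agree.lamInf_le (h : Agree N x x') : lamInf ξ x' y ≤ lamInf ξ x y + 2 * 2⁻¹ ^ N := by
  classical
  induction N using Nat.strong_induction_on generalizing x x' y with
  | _ N ih =>
  by_cases hN : ∀ k < N, x.val k ∈ imageEdges ξ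
  · have hx : invOut ξ x ≤ 2⁻¹ ^ (N + 1) := invOut_le_of_forall_mem hN
    have hx' : invOut ξ x' ≤ 2⁻¹ ^ (N + 1) := invOut_le_of_forall_mem fun k hk => h k hk ▸ hN k hk
    have hinv : |invOut ξ x' - invOut ξ y| ≤ |invOut ξ x - invOut ξ y| + 2⁻¹ ^ (N + 1) := by
      have hxx' := abs_sub_le_of_nonneg_of_le (invOut_nonneg x') hx' (invOut_nonneg x) hx
      linarith [abs_sub_le (invOut ξ x') (invOut ξ x) (invOut ξ y)]
    have hdist := dist_triangle_left (angle ξ x') (angle ξ y) (angle ξ x)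
    have hangle := h.dist_angle_le (ξ := ξ)
    have hlow := abs_invOut_sub_add_dist_angle_le_lamInf (ξ := ξ) x y
    have hup := XiFactor.lamInf_le (ξ := ξ) x' y
    rw [pow_succ] at hx' hinv
    linarith [show (0 : ℝ) < 2⁻¹ ^ N by positivity]
  · push Not at hN
    obtain ⟨m, hmN, hm⟩ := hN
    obtain ⟨n, hnm, hn⟩ := exists_firstExit_le hm
    have hagree : Agree (n + 1) x x' := h.mono (by omega)
    have hn' := hn.of_agree hagree
    rw [lamInf_eq x' y, lamInf_eq x y, hn.invOut_eq, hn'.invOut_eq, hn.angle_eq_of_agree hagree]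
    split_ifs
    · have hafter : lamInf ξ (afterOut ξ x') (afterOut ξ y) ≤
          lamInf ξ (afterOut ξ x) (afterOut ξ y) + 2 * 2⁻¹ ^ (N - (n + 1)) := by
        refine ih _ (by omega) ?_
        rw [afterOut, afterOut, hn.firstOut_eq, hn'.firstOut_eq]
        exact h.iterate_shiftPos
      have hpow : (2 : ℝ)⁻¹ ^ (n + 1) * 2⁻¹ ^ (N - (n + 1)) = 2⁻¹ ^ N := by
        rw [← pow_add, Nat.add_sub_cancel' (by omega)]
      have hmul := mul_le_mul_of_nonneg_left hafter (by positivity : (0 : ℝ) ≤ 2⁻¹ ^ (n + 1) / 4)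
      linarith [show (0 : ℝ) < 2⁻¹ ^ N by positivity]
    · exact le_add_of_nonneg_right (by positivity)

theorem setOf_notMem_eq_of_code_eq (hinj : Function.Injective (edgeMap ξ))
    (h : code ξ x = code ξ y) :
    {n | x.val n ∉ imageEdges ξ} = {n | y.val n ∉ imageEdges ξ} :=
  Set.ext fun n => (mem_imageEdges_iff_of_edgeClass_eq hinj (edgeClass_eq_of_code_eq h n)).not

theorem invOut_eq_of_code_eq (hinj : Function.Injective (edgeMap ξ)) (h : code ξ x = code ξ y) :
    invOut ξ x = invOut ξ y := by
  rw [invOut, invOut, kappa, firstOut, setOf_notMem_eq_of_code_eq hinj h, ← kappa, ← firstOut]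

theorem code_afterOut_eq (hinj : Function.Injective (edgeMap ξ)) (h : code ξ x = code ξ y) :
    code ξ (afterOut ξ x) = code ξ (afterOut ξ y) := by
  rw [afterOut, afterOut, firstOut, setOf_notMem_eq_of_code_eq hinj h]
  exact code_iterate_shiftPos_eq h _

theorem lamTerm_eq_of_code_eq (hinj : Function.Injective (edgeMap ξ)) (hx : code ξ x = code ξ x')
    (hy : code ξ y = code ξ y') (k : ℕ) : lamTerm ξ k x y = lamTerm ξ k x' y' := by
  induction k generalizing x x' y y' with
  | zero =>
    rw [lamTerm, lamTerm, invOut_eq_of_code_eq hinj hx, invOut_eq_of_code_eq hinj hy,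
      angle_eq_of_code_eq hx, angle_eq_of_code_eq hy]
  | succ k ih =>
    rw [lamTerm, lamTerm, invOut_eq_of_code_eq hinj hx, invOut_eq_of_code_eq hinj hy,
      angle_eq_of_code_eq hx, angle_eq_of_code_eq hy,
      ih (code_afterOut_eq hinj hx) (code_afterOut_eq hinj hy)]

theorem lamInf_eq_of_code_eq (hinj : Function.Injective (edgeMap ξ)) (hx : code ξ x = code ξ x')
    (hy : code ξ y = code ξ y') : lamInf ξ x y = lamInf ξ x' y' :=
  tsum_congr (lamTerm_eq_of_code_eq hinj hx hy)

theorem dCircle_theta (x y : OneSided G) :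
    dCircle (theta ξ x) (theta ξ y) = dist (angle ξ x) (angle ξ y) := by
  rw [theta_eq_toCircle_angle, theta_eq_toCircle_angle, dCircle_toCircle]

theorem lam_eq_lamInf (k : ℕ) (hx : kappa ξ x = k) (hy : kappa ξ y = k) :
    lam ξ k x y = lamInf ξ x y := by
  induction k generalizing x y with
  | zero =>
    have hx0 : invOut ξ x = 0 := if_pos hx
    have hy0 : invOut ξ y = 0 := if_pos hy
    rw [lam, dCircle_theta, lamInf_eq, hx0, hy0]
    simp
  | succ k ih =>
    have hne {w : OneSided G} (hw : kappa ξ w = (k + 1 : ℕ)) : kappa ξ w ≠ 0 := by simp [hw]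
    have hafter {w : OneSided G} (hw : kappa ξ w = (k + 1 : ℕ)) : kappa ξ (afterOut ξ w) = k :=
      (ENat.add_left_injective_of_ne_top ENat.one_ne_top
        (hw.symm.trans (kappa_eq_kappa_afterOut_add_one (hne hw)))).symm
    have hrest := ih (hafter hx) (hafter hy)
    rw [afterOut, afterOut] at hrest
    have hinv {w : OneSided G} (hw : kappa ξ w = (k + 1 : ℕ)) :
        invOut ξ w = (2 : ℝ)⁻¹ ^ firstOut ξ w := if_neg (hne hw)
    have hpow : (2 : ℝ)⁻¹ ^ (2 + firstOut ξ x) = invOut ξ x / 4 := by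
      rw [hinv hx, pow_add]
      ring
    simp only [lam, lamInf_eq x y, dCircle_theta, theta_eq_iff, ← invOut_eq_iff (hne hx) (hne hy),
      hpow, ← hinv hx, ← hinv hy, afterOut, hrest]

end Lambda

section Density

variable {W F V E : Type*} {H : EdgeGraph W F} {G : EdgeGraph V E} {ξ : Fin 2 → Embedding H G}

/-- The path `x` with the edge `e` put in front of it. -/
def consPath (e : E) (x : OneSided G) (h : G.t e = G.i (x.val 0)) : OneSided G :=
  ⟨fun n => Nat.casesOn n e x.val, fun n => by
    cases n with
    | zero => exact h
    | succ n => exact x.isPath n⟩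

theorem kappa_consPath_of_notMem {e : E} {x : OneSided G} {h : G.t e = G.i (x.val 0)}
    (he : e ∉ imageEdges ξ) : kappa ξ (consPath e x h) = kappa ξ x + 1 :=
  kappa_of_notMem he

variable (ξ) in
/-- On the set `s` of paths, `κ` takes all sufficiently large finite values. -/
def AttainsLargeKappa (s : Set (OneSided G)) : Prop :=
  ∀ᶠ c : ℕ in atTop, ∃ x ∈ s, kappa ξ x = c

theorem AttainsLargeKappa.mono {s s' : Set (OneSided G)} (h : AttainsLargeKappa ξ s)
    (hs : s ⊆ s') : AttainsLargeKappa ξ s' :=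
  Eventually.mono h fun _ ⟨x, hx, hk⟩ => ⟨x, hs hx, hk⟩

theorem AttainsLargeKappa.cons {s : Set (OneSided G)} (h : AttainsLargeKappa ξ s) {e : E}
    (he : ∀ x ∈ s, G.t e = G.i (x.val 0)) :
    AttainsLargeKappa ξ {x | x.val 0 = e ∧ shiftPos x ∈ s} := by
  by_cases hmem : e ∈ imageEdges ξ
  · exact Eventually.mono h fun c ⟨x, hx, hk⟩ =>
      ⟨consPath e x (he x hx), ⟨rfl, hx⟩, (kappa_of_mem hmem).trans hk⟩
  · filter_upwards [(tendsto_sub_atTop_nat 1).eventually h, eventually_ge_atTop 1]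
      with c ⟨x, hx, hk⟩ hc
    refine ⟨consPath e x (he x hx), ⟨rfl, hx⟩, ?_⟩
    rw [kappa_consPath_of_notMem hmem, hk, ← ENat.natCast_one, ← ENat.natCast_add,
      Nat.sub_add_cancel hc]

theorem of_adj_pow_pos [Fintype V] [DecidableEq V] {P : V → Prop}
    (hP : ∀ e, P (G.t e) → P (G.i e)) {k : ℕ} {v w : V} (hpos : 0 < (G.adj ^ k) w v) (hw : P w) :
    P v := by
  induction k generalizing w with
  | zero =>
    rw [pow_zero, Matrix.one_apply] at hpos
    split_ifs at hpos with heq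
    · exact heq ▸ hw
    · exact absurd hpos (lt_irrefl 0)
  | succ k ih =>
    rw [pow_succ', Matrix.mul_apply] at hpos
    obtain ⟨u, -, hu⟩ := Finset.exists_ne_zero_of_sum_ne_zero hpos.ne'
    obtain ⟨⟨⟨e, rfl, rfl⟩⟩, -⟩ := Nat.card_ne_zero.1 (left_ne_zero_of_mul hu : G.adj w u ≠ 0)
    exact ih (Nat.pos_of_ne_zero (right_ne_zero_of_mul hu)) (hP e hw)

theorem exists_path_over_kappa_eq
    (h2 : ∀ y : F, ∃ e : E, G.t e = G.t ((ξ 0).onE y) ∧ G.i e = G.i ((ξ 0).onE y) ∧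
      e ∉ imageEdges ξ) (z : OneSided H) (c : ℕ) :
    ∃ x : OneSided G, G.i (x.val 0) = (ξ 0).onV (H.i (z.val 0)) ∧ kappa ξ x = c := by
  induction c generalizing z with
  | zero =>
    refine ⟨⟨fun n => (ξ 0).onE (z.val n), fun n => ?_⟩, (ξ 0).map_i _,
      kappa_eq_zero_iff.2 fun n => Or.inl ⟨_, rfl⟩⟩
    rw [(ξ 0).map_t, (ξ 0).map_i, z.isPath]
  | succ c ih =>
    obtain ⟨x, hx, hk⟩ := ih (shiftPos z)
    obtain ⟨e, het, hei, hem⟩ := h2 (z.val 0)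
    have hpath : G.t e = G.i (x.val 0) := by
      rw [het, hx, (ξ 0).map_t, z.isPath]
      rfl
    exact ⟨consPath e x hpath, hei.trans ((ξ 0).map_i _),
      by rw [kappa_consPath_of_notMem hem, hk, Nat.cast_succ]⟩

theorem attainsLargeKappa_from_vertex [Fintype V] [DecidableEq V] (hξ : StandingHypotheses ξ)
    (z : OneSided H) (v : V) : AttainsLargeKappa ξ {x | G.i (x.val 0) = v} := by
  obtain ⟨k, -, hk⟩ := hξ.primitive
  refine of_adj_pow_pos (P := fun v => AttainsLargeKappa ξ {x | G.i (x.val 0) = v})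
    (fun e he => ?_) (hk v ((ξ 0).onV (H.i (z.val 0))))
    (Eventually.of_forall (exists_path_over_kappa_eq hξ.h2 z))
  exact (he.cons fun x hx => Eq.symm hx).mono fun x hx => congrArg G.i hx.1

theorem AttainsLargeKappa.agree
    (h : ∀ v, AttainsLargeKappa ξ {x : OneSided G | G.i (x.val 0) = v}) (N : ℕ) (x : OneSided G) :
    AttainsLargeKappa ξ {x' | Agree N x x' ∧ G.i (x'.val 0) = G.i (x.val 0)} := by
  induction N generalizing x with
  | zero => exact (h _).mono fun x' hx' => ⟨fun k hk => absurd hk k.not_lt_zero, hx'⟩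
  | succ N ih =>
    refine ((ih (shiftPos x)).cons (e := x.val 0) fun x' hx' => (x.isPath 0).trans hx'.2.symm).mono
      fun x' ⟨hx0, hagree, _⟩ => ⟨fun k hk => ?_, congrArg G.i hx0⟩
    cases k with
    | zero => exact hx0.symm
    | succ k => exact hagree k (Nat.lt_of_succ_lt_succ hk)

variable (ξ) in
/-- The union of the sets `κ⁻¹{k} × κ⁻¹{k}`, `k < ∞`, on which the functions `d_k` are given. -/
def levelPairs : Set (OneSided G × OneSided G) :=
  {p | kappa ξ p.1 = kappa ξ p.2 ∧ kappa ξ p.1 ≠ ⊤}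

theorem dense_levelPairs [Fintype V] [DecidableEq V] (hξ : StandingHypotheses ξ)
    (hH : Nonempty (TwoSided H)) : Dense (levelPairs ξ) := by
  obtain ⟨z⟩ := hH
  have hlarge := AttainsLargeKappa.agree (attainsLargeKappa_from_vertex hξ (tailFrom z 0))
  rintro ⟨x, y⟩
  rw [mem_closure_iff_nhds]
  intro s hs
  obtain ⟨u, hu, v, hv, huv⟩ := mem_nhds_prod_iff.1 hs
  obtain ⟨M, hM⟩ := mem_nhds_oneSided.1 hu
  obtain ⟨N, hN⟩ := mem_nhds_oneSided.1 hv
  obtain ⟨c, ⟨x', ⟨hx', -⟩, hkx⟩, ⟨y', ⟨hy', -⟩, hky⟩⟩ := ((hlarge M x).and (hlarge N y)).exists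
  exact ⟨(x', y'), huv ⟨hM x' hx', hN y' hy'⟩, hkx.trans hky.symm, hkx ▸ ENat.natCast_ne_top c⟩

end Density

section FactorMetric

variable {W F V E : Type*} {H : EdgeGraph W F} {G : EdgeGraph V E} {ξ : Fin 2 → Embedding H G}
  {x x' y y' : OneSided G} {N : ℕ}

theorem Agree.tau (h : Agree N x y) (h0 : (ξ 0).onV = (ξ 1).onV) :
    Agree N (tau ξ h0 x) (tau ξ h0 y) :=
  fun k hk => congrArg (edgeClass ξ) (h k hk)

/-- The pseudo-metric `d` on one-sided paths, in closed form. -/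
noncomputable def dOne (h0 : (ξ 0).onV = (ξ 1).onV) (x y : OneSided G) : ℝ :=
  dPos (tau ξ h0 x) (tau ξ h0 y) + lamInf ξ x y

theorem dOne_nonneg (h0 : (ξ 0).onV = (ξ 1).onV) (x y : OneSided G) : 0 ≤ dOne h0 x y :=
  add_nonneg (dPos_nonneg _ _) (lamInf_nonneg _ _)

theorem dOne_comm (h0 : (ξ 0).onV = (ξ 1).onV) (x y : OneSided G) :
    dOne h0 x y = dOne h0 y x := by
  rw [dOne, dPos_comm, lamInf_comm, dOne]

theorem Agree.dOne_le_add (h : Agree N x x') (h0 : (ξ 0).onV = (ξ 1).onV) :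
    dOne h0 x' y ≤ dOne h0 x y + 3 * 2⁻¹ ^ N := by
  have hpos := (h.tau h0).dPos_le (y := XiFactor.tau ξ h0 y)
  have hlam := h.lamInf_le (ξ := ξ) (y := y)
  rw [dOne, dOne]
  linarith

theorem Agree.dOne_le (h : Agree N x y) (h0 : (ξ 0).onV = (ξ 1).onV) :
    dOne h0 x y ≤ 3 * 2⁻¹ ^ N := by
  have hself : dOne h0 y y = 0 := by rw [dOne, dPos_self, lamInf_self, add_zero]
  simpa only [hself, zero_add] using h.symm.dOne_le_add (y := y) h0

theorem dOne_le_three (h0 : (ξ 0).onV = (ξ 1).onV) (x y : OneSided G) : dOne h0 x y ≤ 3 := by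
  simpa using Agree.dOne_le (N := 0) (x := x) (y := y) (fun k hk => absurd hk k.not_lt_zero) h0

theorem edgeClass_eq_of_dOne_lt_one {h0 : (ξ 0).onV = (ξ 1).onV} (h : dOne h0 x y < 1) :
    edgeClass ξ (x.val 0) = edgeClass ξ (y.val 0) := by
  have hpos : dPos (tau ξ h0 x) (tau ξ h0 y) < (2 : ℝ)⁻¹ ^ 0 := by
    rw [pow_zero]
    exact (le_add_of_nonneg_right (lamInf_nonneg x y)).trans_lt h
  exact agree_of_dPos_lt hpos 0 one_pos

theorem dist_angle_le_dOne (h0 : (ξ 0).onV = (ξ 1).onV) (x y : OneSided G) :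
    dist (angle ξ x) (angle ξ y) ≤ dOne h0 x y :=
  (dist_angle_le_lamInf x y).trans (le_add_of_nonneg_left (dPos_nonneg _ _))

theorem dOne_eq_of_code_eq (hinj : Function.Injective (edgeMap ξ)) (h0 : (ξ 0).onV = (ξ 1).onV)
    (hx : code ξ x = code ξ x') (hy : code ξ y = code ξ y') : dOne h0 x y = dOne h0 x' y' := by
  have htau {u v : OneSided G} (h : code ξ u = code ξ v) : tau ξ h0 u = tau ξ h0 v :=
    OneSided.ext (funext (edgeClass_eq_of_code_eq h))
  rw [dOne, dOne, htau hx, htau hy, lamInf_eq_of_code_eq hinj hx hy]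

theorem continuous_dOne (h0 : (ξ 0).onV = (ξ 1).onV) :
    Continuous fun p : OneSided G × OneSided G => dOne h0 p.1 p.2 := by
  have hle {N : ℕ} {x x' y y' : OneSided G} (hx : Agree N x x') (hy : Agree N y y') :
      dOne h0 x' y' ≤ dOne h0 x y + 6 * 2⁻¹ ^ N := by
    have hx' := hx.dOne_le_add (y := y') h0
    have hy' := hy.dOne_le_add (y := x) h0
    rw [dOne_comm h0 y' x, dOne_comm h0 y x] at hy'
    linarith
  refine continuous_iff_continuousAt.2 fun ⟨x, y⟩ => Metric.tendsto_nhds.2 fun η hη => ?_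
  obtain ⟨N, hN⟩ := exists_pow_lt_of_lt_one (div_pos hη (by norm_num : (0 : ℝ) < 6))
    (by norm_num : (2 : ℝ)⁻¹ < 1)
  filter_upwards [prod_mem_nhds (mem_nhds_oneSided.2 ⟨N, fun _ h => h⟩ : {x' | Agree N x x'} ∈ 𝓝 x)
    (mem_nhds_oneSided.2 ⟨N, fun _ h => h⟩ : {y' | Agree N y y'} ∈ 𝓝 y)]
  rintro ⟨x', y'⟩ ⟨hx, hy⟩
  rw [Real.dist_eq, abs_lt]
  constructor <;> linarith [hle hx hy, hle hx.symm hy.symm]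

theorem dExt_eq_dOne (h0 : (ξ 0).onV = (ξ 1).onV) (hd : Dense (levelPairs ξ)) (x y : OneSided G) :
    dExt ξ h0 x y = dOne h0 x y := by
  refine extendFrom_eq (hd _)
    ((((continuous_dOne h0).tendsto (x, y)).mono_left nhdsWithin_le_nhds).congr' ?_)
  filter_upwards [self_mem_nhdsWithin]
  rintro ⟨x', y'⟩ ⟨hk, htop⟩
  have hx : kappa ξ x' = (kappa ξ x').toNat := (ENat.natCast_toNat htop).symm
  exact congrArg _ (lam_eq_lamInf _ hx (hk.symm.trans hx)).symm

theorem dQuot_piPos (hinj : Function.Injective (edgeMap ξ)) (h0 : (ξ 0).onV = (ξ 1).onV)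
    (hd : Dense (levelPairs ξ)) (x y : OneSided G) :
    dQuot ξ h0 (piPos ξ x) (piPos ξ y) = dOne h0 x y := by
  have hout (w : OneSided G) : code ξ (Quot.out (piPos ξ w)) = code ξ w :=
    (piPos_eq_iff hinj).1 (Quot.out_eq (piPos ξ w))
  rw [dQuot, dExt_eq_dOne h0 hd, dOne_eq_of_code_eq hinj h0 (hout x) (hout y)]

end FactorMetric

section TwoSided

variable {V E : Type*} {G : EdgeGraph V E} {x y : TwoSided G}

theorem dTwo_nonneg (x y : TwoSided G) : 0 ≤ dTwo x y := sInf_inv_two_pow_nonneg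

theorem dTwo_le {N : ℕ} (h : ∀ j : ℤ, 1 - (N : ℤ) ≤ j → j ≤ N → x.val j = y.val j) :
    dTwo x y ≤ (2 : ℝ)⁻¹ ^ N :=
  sInf_inv_two_pow_le h

theorem eq_of_dTwo_lt {N : ℕ} (h : dTwo x y < (2 : ℝ)⁻¹ ^ N) {j : ℤ} (hj : -(N : ℤ) ≤ j)
    (hj' : j ≤ N + 1) : x.val j = y.val j := by
  obtain ⟨n, hn, hxy⟩ :=
    exists_gt_of_sInf_inv_two_pow_lt (fun j h h' => absurd (h.trans h') (by norm_num)) h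
  exact hxy j (by omega) (by omega)

theorem iterate_shiftTwo_val (n : ℕ) (x : TwoSided G) (j : ℤ) :
    (shiftTwo^[n] x).val j = x.val (j + n) := by
  induction n generalizing x with
  | zero => simp
  | succ n ih =>
    rw [Function.iterate_succ_apply, ih, Nat.cast_succ, ← add_assoc]
    rfl

theorem mem_stableSet_dTwo_iff :
    y ∈ stableSet dTwo shiftTwo x ↔ ∀ᶠ j : ℤ in atTop, x.val j = y.val j := by
  constructor
  · intro h
    obtain ⟨N, hN⟩ := eventually_atTop.1 ((tendsto_order.1 h).2 ((2 : ℝ)⁻¹ ^ 0) (by norm_num))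
    filter_upwards [eventually_ge_atTop (N : ℤ)] with j hj
    lift j to ℕ using (by omega)
    have h0 := eq_of_dTwo_lt (hN j (by omega)) (j := 0) (by simp) (by simp)
    rwa [iterate_shiftTwo_val, iterate_shiftTwo_val, zero_add] at h0
  · intro h
    obtain ⟨M, hM⟩ := eventually_atTop.1 h
    refine squeeze_zero' (g := fun n : ℕ => (2 : ℝ)⁻¹ ^ (n - M.toNat))
      (Eventually.of_forall fun n => dTwo_nonneg _ _) ?_ ?_
    · filter_upwards [eventually_ge_atTop M.toNat] with n hn
      refine dTwo_le fun j hj _ => ?_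
      rw [iterate_shiftTwo_val, iterate_shiftTwo_val]
      exact hM _ (by omega)
    · exact (tendsto_pow_atTop_nhds_zero_of_lt_one (by norm_num) (by norm_num)).comp
        (tendsto_sub_atTop_nat _)

/-- The one-sided path `(x_j, x_{j+1}, …)`. -/
def pathAt (x : TwoSided G) (j : ℤ) : OneSided G :=
  ⟨fun k => x.val (j + k), fun k => by rw [Nat.cast_succ, ← add_assoc]; exact x.isPath _⟩

theorem tailFrom_eq_pathAt (x : TwoSided G) (n : ℕ) : tailFrom x n = pathAt x (1 - n) := by
  ext k
  exact congrArg x.val (by ring)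

theorem iterate_shiftPos_pathAt (x : TwoSided G) (j : ℤ) (n : ℕ) :
    shiftPos^[n] (pathAt x j) = pathAt x (j + n) := by
  ext k
  rw [iterate_shiftPos_val]
  exact congrArg x.val (by push_cast; ring)

theorem tailFrom_iterate_shiftTwo (x : TwoSided G) (m n : ℕ) :
    tailFrom (shiftTwo^[m] x) n = shiftPos^[m] (tailFrom x n) := by
  ext k
  rw [iterate_shiftPos_val]
  exact (iterate_shiftTwo_val m x _).trans (congrArg x.val (by push_cast; ring))

theorem exists_tailFrom_eq (s : ℕ → OneSided G) (hs : ∀ n, shiftPos (s (n + 1)) = s n) :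
    ∃ x : TwoSided G, ∀ n, tailFrom x n = s n := by
  have hadd (n k d : ℕ) : (s n).val k = (s (n + d)).val (k + d) := by
    induction d with
    | zero => rfl
    | succ d ih => rw [ih, ← hs (n + d)]; rfl
  have hsub (n m k l : ℕ) (h : (k : ℤ) - n = l - m) : (s n).val k = (s m).val l := by
    rcases le_total n m with hnm | hnm
    · rw [hadd n k (m - n), show n + (m - n) = m by omega, show k + (m - n) = l by omega]
    · rw [hadd m l (n - m), show m + (n - m) = n by omega, show l + (n - m) = k by omega]
  refine ⟨⟨fun j => (s (1 - j).toNat).val (j - 1 + (1 - j).toNat).toNat, fun j => ?_⟩,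
    fun n => OneSided.ext (funext fun k => hsub _ _ _ _ (by omega))⟩
  rw [(s (1 - j).toNat).isPath, hsub _ (1 - (j + 1)).toNat _ (j + 1 - 1 + (1 - (j + 1)).toNat).toNat
    (by omega)]

theorem continuous_tailFrom (n : ℕ) : Continuous fun x : TwoSided G => tailFrom x n := by
  let _ : TopologicalSpace E := ⊥
  have hval : Continuous fun x : TwoSided G => x.val := continuous_induced_dom
  exact continuous_induced_rng.2
    (continuous_pi fun k => (continuous_apply (1 + (k : ℤ) - n)).comp hval)

end TwoSided

section Factor

variable {W F V E : Type*} {H : EdgeGraph W F} {G : EdgeGraph V E} {ξ : Fin 2 → Embedding H G}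
  {x y : TwoSided G}

theorem piTwo_eq_iff (hinj : Function.Injective (edgeMap ξ)) :
    piTwo ξ x = piTwo ξ y ↔ ∀ n, code ξ (tailFrom x n) = code ξ (tailFrom y n) := by
  rw [InvLim.ext_iff, funext_iff]
  exact forall_congr' fun n => piPos_eq_iff hinj

theorem code_pathAt_eq (hinj : Function.Injective (edgeMap ξ)) (h : piTwo ξ x = piTwo ξ y)
    (j : ℤ) : code ξ (pathAt x j) = code ξ (pathAt y j) := by
  have hn := code_iterate_shiftPos_eq ((piTwo_eq_iff hinj).1 h (1 - j).toNat) (j - 1).toNat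
  rwa [tailFrom_eq_pathAt, tailFrom_eq_pathAt, iterate_shiftPos_pathAt, iterate_shiftPos_pathAt,
    show (1 - ((1 - j).toNat : ℤ) + (j - 1).toNat) = j by omega] at hn

theorem piTwo_shiftTwo (x : TwoSided G) : piTwo ξ (shiftTwo x) = shiftLim ξ (piTwo ξ x) := by
  ext n
  exact congrArg (piPos ξ) (tailFrom_iterate_shiftTwo x 1 n)

theorem iterate_shiftLim_piTwo (n : ℕ) (x : TwoSided G) :
    (shiftLim ξ)^[n] (piTwo ξ x) = piTwo ξ (shiftTwo^[n] x) :=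
  ((Function.Semiconj.iterate_right (f := piTwo ξ) piTwo_shiftTwo n) x).symm

theorem continuous_piTwo : Continuous (piTwo ξ) :=
  continuous_induced_rng.2 (continuous_pi fun n =>
    (continuous_quot_mk (r := Rel ξ)).comp (continuous_tailFrom n))

theorem dLim_piTwo (hinj : Function.Injective (edgeMap ξ)) (h0 : (ξ 0).onV = (ξ 1).onV)
    (hd : Dense (levelPairs ξ)) (x y : TwoSided G) :
    dLim ξ h0 (piTwo ξ x) (piTwo ξ y) =
      ⨆ n : ℕ, (2 : ℝ)⁻¹ ^ n * dOne h0 (tailFrom x n) (tailFrom y n) :=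
  iSup_congr fun _ => congrArg _ (dQuot_piPos hinj h0 hd _ _)

theorem dOne_tailFrom_zero_le_dLim (hinj : Function.Injective (edgeMap ξ))
    (h0 : (ξ 0).onV = (ξ 1).onV) (hd : Dense (levelPairs ξ)) (x y : TwoSided G) :
    dOne h0 (tailFrom x 0) (tailFrom y 0) ≤ dLim ξ h0 (piTwo ξ x) (piTwo ξ y) := by
  have hbdd : BddAbove (range fun n : ℕ =>
      (2 : ℝ)⁻¹ ^ n * dOne h0 (tailFrom x n) (tailFrom y n)) := by
    refine ⟨3, ?_⟩
    rintro _ ⟨n, rfl⟩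
    exact (mul_le_of_le_one_left (dOne_nonneg _ _ _)
      (pow_le_one₀ (by norm_num) (by norm_num))).trans (dOne_le_three _ _ _)
  rw [dLim_piTwo hinj h0 hd]
  simpa using le_ciSup hbdd 0

theorem dLim_nonneg (hinj : Function.Injective (edgeMap ξ)) (h0 : (ξ 0).onV = (ξ 1).onV)
    (hd : Dense (levelPairs ξ)) (x y : TwoSided G) :
    0 ≤ dLim ξ h0 (piTwo ξ x) (piTwo ξ y) :=
  (dOne_nonneg _ _ _).trans (dOne_tailFrom_zero_le_dLim hinj h0 hd x y)

theorem dLim_le_of_dTwo_lt (hinj : Function.Injective (edgeMap ξ)) (h0 : (ξ 0).onV = (ξ 1).onV)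
    (hd : Dense (levelPairs ξ)) {N : ℕ} (h : dTwo x y < (2 : ℝ)⁻¹ ^ N) :
    dLim ξ h0 (piTwo ξ x) (piTwo ξ y) ≤ 3 * (2 : ℝ)⁻¹ ^ (N + 1) := by
  rw [dLim_piTwo hinj h0 hd]
  refine ciSup_le fun n => ?_
  rcases le_total n (N + 1) with hn | hn
  · have hagree : Agree (N + 1) (tailFrom x n) (tailFrom y n) :=
      fun k hk => eq_of_dTwo_lt h (by omega) (by omega)
    exact (mul_le_of_le_one_left (dOne_nonneg _ _ _)
      (pow_le_one₀ (by norm_num) (by norm_num))).trans (hagree.dOne_le h0)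
  · rw [mul_comm]
    exact mul_le_mul (dOne_le_three _ _ _) (pow_le_pow_of_le_one (by norm_num) (by norm_num) hn)
      (by positivity) (by norm_num)

theorem exists_dLim_lt (hinj : Function.Injective (edgeMap ξ)) (h0 : (ξ 0).onV = (ξ 1).onV)
    (hd : Dense (levelPairs ξ)) {η : ℝ} (hη : 0 < η) :
    ∃ δ : ℝ, 0 < δ ∧ ∀ x y : TwoSided G, dTwo x y < δ →
      dLim ξ h0 (piTwo ξ x) (piTwo ξ y) < η := by
  obtain ⟨N, hN⟩ := exists_pow_lt_of_lt_one (div_pos hη (by norm_num : (0 : ℝ) < 3))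
    (by norm_num : (2 : ℝ)⁻¹ < 1)
  refine ⟨2⁻¹ ^ N, by positivity, fun x y h => (dLim_le_of_dTwo_lt hinj h0 hd h).trans_lt ?_⟩
  rw [pow_succ]
  linarith [show (0 : ℝ) < 2⁻¹ ^ N by positivity]

end Factor

section Flips

variable {W F V E : Type*} {H : EdgeGraph W F} {G : EdgeGraph V E} {ξ : Fin 2 → Embedding H G}
  {i j : Fin 2} {e e' : E} {x y : TwoSided G}

theorem onV_eq (h0 : (ξ 0).onV = (ξ 1).onV) (i j : Fin 2) : (ξ i).onV = (ξ j).onV := by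
  fin_cases i <;> fin_cases j
  exacts [rfl, h0, h0.symm, rfl]

theorem t_eq_i_of_onE (h0 : (ξ 0).onV = (ξ 1).onV) {a b : F}
    (h : G.t ((ξ i).onE a) = G.i ((ξ j).onE b)) : H.t a = H.i b := by
  rw [(ξ i).map_t, (ξ j).map_i, onV_eq h0 i j] at h
  exact (ξ j).injV h

theorem Flipped.i_eq (h0 : (ξ 0).onV = (ξ 1).onV) (h : Flipped ξ i e e') : G.i e = G.i e' := by
  obtain ⟨y, rfl, rfl⟩ := h
  rw [(ξ i).map_i, (ξ (1 - i)).map_i, onV_eq h0 i (1 - i)]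

theorem Flipped.t_eq (h0 : (ξ 0).onV = (ξ 1).onV) (h : Flipped ξ i e e') : G.t e = G.t e' := by
  obtain ⟨y, rfl, rfl⟩ := h
  rw [(ξ i).map_t, (ξ (1 - i)).map_t, onV_eq h0 i (1 - i)]

theorem fullFlip_iff (h0 : (ξ 0).onV = (ξ 1).onV) :
    FullFlip ξ x y ↔ ∃ i, ∀ n, Flipped ξ i (x.val n) (y.val n) := by
  constructor
  · rintro ⟨i, z, hz⟩
    exact ⟨i, fun n => ⟨z.val n, hz n⟩⟩
  · rintro ⟨i, h⟩
    choose z hz using h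
    refine ⟨i, ⟨z, fun n => t_eq_i_of_onE (i := i) (j := i) h0 ?_⟩, hz⟩
    rw [← (hz n).1, ← (hz (n + 1)).1, x.isPath]

theorem tailFlip_iff (h0 : (ξ 0).onV = (ξ 1).onV) :
    TailFlip ξ x y ↔ ∃ (m : ℤ) (i : Fin 2), (∀ n < m, x.val n = y.val n) ∧
      ((x.val m = y.val m ∧ x.val m ∉ imageEdges ξ) ∨ Flipped ξ (1 - i) (x.val m) (y.val m)) ∧
      ∀ n, m < n → Flipped ξ i (x.val n) (y.val n) := by
  constructor
  · rintro ⟨m, i, z, hlt, hm, hz⟩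
    refine ⟨m, i, hlt, hm.imp_right fun ⟨e, _, hx, hy⟩ => ⟨e, hx, by rwa [sub_sub_cancel]⟩,
      fun n hn => ?_⟩
    obtain ⟨k, rfl⟩ := Int.exists_add_of_le (Int.add_one_le_of_lt hn)
    exact ⟨z.val k, hz k⟩
  · rintro ⟨m, i, hlt, hm, hgt⟩
    choose z hz using fun k : ℕ => hgt (m + 1 + k) (by omega)
    refine ⟨m, i, ⟨z, fun k => t_eq_i_of_onE (i := i) (j := i) h0 ?_⟩, hlt,
      hm.imp_right fun ⟨e, hx, hy⟩ => ⟨e, t_eq_i_of_onE (i := 1 - i) (j := i) h0 ?_, hx, ?_⟩, hz⟩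
    · rw [← (hz k).1, ← (hz (k + 1)).1, x.isPath, Nat.cast_succ, add_assoc _ (k : ℤ)]
    · rw [← hx, ← (hz 0).1, x.isPath, Nat.cast_zero, add_zero]
    · rwa [sub_sub_cancel] at hy

theorem piTwo_eq_of_rel (h : ∀ j, Rel ξ (pathAt x j) (pathAt y j)) : piTwo ξ x = piTwo ξ y :=
  InvLim.ext (funext fun n => Quot.sound (by
    rw [tailFrom_eq_pathAt, tailFrom_eq_pathAt]
    exact h _))

theorem FullFlip.piTwo_eq (h0 : (ξ 0).onV = (ξ 1).onV) (h : FullFlip ξ x y) :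
    piTwo ξ x = piTwo ξ y := by
  obtain ⟨i, hflip⟩ := (fullFlip_iff h0).1 h
  exact piTwo_eq_of_rel fun j => Or.inr (Or.inr (flip₂_iff.2
    ⟨0, i, fun k hk => absurd hk k.not_lt_zero, fun k hk => absurd hk k.succ_ne_zero,
      fun k _ => hflip _⟩))

theorem TailFlip.piTwo_eq (h0 : (ξ 0).onV = (ξ 1).onV) (h : TailFlip ξ x y) :
    piTwo ξ x = piTwo ξ y := by
  obtain ⟨m, i, hlt, hm, hgt⟩ := (tailFlip_iff h0).1 h
  refine piTwo_eq_of_rel fun j => Or.inr ?_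
  rcases lt_or_ge m j with hj | hj
  · exact Or.inr (flip₂_iff.2 ⟨0, i, fun k hk => absurd hk k.not_lt_zero,
      fun k hk => absurd hk k.succ_ne_zero, fun k _ => hgt _ (by omega)⟩)
  obtain ⟨p, rfl⟩ := Int.exists_add_of_le hj
  have hagree : Agree p (pathAt x j) (pathAt y j) := fun k hk => hlt _ (by omega)
  rcases hm with ⟨heq, hout⟩ | hflip
  · refine Or.inr (flip₂_iff.2 ⟨p + 1, i, fun k hk => ?_, fun k hk => ?_,
      fun k hk => hgt _ (by omega)⟩)
    · rcases Nat.lt_succ_iff_lt_or_eq.1 hk with hk | rfl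
      exacts [hagree k hk, heq]
    · rwa [Nat.succ_injective hk]
  · exact Or.inl (flip₁_iff.2 ⟨p, i, hagree, hflip, fun k hk => hgt _ (by omega)⟩)

theorem exists_forall_gt_flipped (hinj : Function.Injective (edgeMap ξ))
    (h : piTwo ξ x = piTwo ξ y) {m : ℤ} (hm : x.val m ≠ y.val m) :
    ∃ i, ∀ n, m < n → Flipped ξ i (x.val n) (y.val n) := by
  obtain ⟨i, hi⟩ := exists_forall_flipped_succ hinj (code_pathAt_eq hinj h m)
    (by simpa only [pathAt, Nat.cast_zero, add_zero] using hm)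
  refine ⟨i, fun n hn => ?_⟩
  obtain ⟨k, rfl⟩ := Int.exists_add_of_le (Int.add_one_le_of_lt hn)
  simpa only [pathAt, Nat.cast_succ, add_assoc, add_comm (1 : ℤ)] using hi k

theorem exists_forall_flipped_of_frequently_ne (hinj : Function.Injective (edgeMap ξ))
    (h : piTwo ξ x = piTwo ξ y) (hne : ∃ᶠ n in atBot, x.val n ≠ y.val n) :
    ∃ i, ∀ n, Flipped ξ i (x.val n) (y.val n) := by
  have hflip (n : ℤ) : ∃ i, ∀ k, n ≤ k → Flipped ξ i (x.val k) (y.val k) := by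
    obtain ⟨m, hm, hxy⟩ := frequently_atBot'.1 hne n
    obtain ⟨i, hi⟩ := exists_forall_gt_flipped hinj h hxy
    exact ⟨i, fun k hk => hi k (hm.trans_le hk)⟩
  choose i hi using hflip
  refine ⟨i 0, fun n => ?_⟩
  have hin : i n = i 0 :=
    (hi n _ (le_max_left n 0)).index_eq hinj (hi 0 _ (le_max_right n 0))
  exact hin ▸ hi n n le_rfl

theorem tailFlip_of_forall_lt_eq (hinj : Function.Injective (edgeMap ξ))
    (h0 : (ξ 0).onV = (ξ 1).onV) (h : piTwo ξ x = piTwo ξ y) {m : ℤ}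
    (hlt : ∀ n < m, x.val n = y.val n) (hm : x.val m ≠ y.val m) : TailFlip ξ x y := by
  obtain ⟨i, hi⟩ := exists_forall_gt_flipped hinj h hm
  have hclass : edgeClass ξ (x.val m) = edgeClass ξ (y.val m) := by
    simpa only [pathAt, Nat.cast_zero, add_zero] using
      edgeClass_eq_of_code_eq (code_pathAt_eq hinj h m) 0
  obtain ⟨j, hj⟩ := flipped_of_edgeClass_eq_of_ne hinj hclass hm
  refine (tailFlip_iff h0).2 ?_
  by_cases hji : j = i
  · subst hji
    have hflip (n : ℤ) (hn : m - 1 < n) : Flipped ξ j (x.val n) (y.val n) := by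
      rcases (Int.le_of_sub_one_lt hn).eq_or_lt with rfl | hn
      exacts [hj, hi n hn]
    have heq : x.val (m - 1) = y.val (m - 1) := hlt _ (sub_one_lt m)
    have hout := notMem_imageEdges_of_angle_eq hinj
      (angle_eq_of_code_eq (code_pathAt_eq hinj h (m - 1)))
      (by simpa only [pathAt, Nat.cast_zero, add_zero] using heq)
      (fun k => hflip _ (by omega))
    refine ⟨m - 1, j, fun n hn => hlt n (by omega), Or.inl ⟨heq, ?_⟩, hflip⟩
    simpa only [pathAt, Nat.cast_zero, add_zero] using hout
  · obtain rfl := fin_two_eq_one_sub_of_ne hji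
    exact ⟨m, i, hlt, Or.inr hj, hi⟩

theorem fullFlip_or_tailFlip_of_piTwo_eq (hinj : Function.Injective (edgeMap ξ))
    (h0 : (ξ 0).onV = (ξ 1).onV) (h : piTwo ξ x = piTwo ξ y) (hxy : x ≠ y) :
    FullFlip ξ x y ∨ TailFlip ξ x y := by
  by_cases hfreq : ∃ᶠ n in atBot, x.val n ≠ y.val n
  · exact Or.inl ((fullFlip_iff h0).2 (exists_forall_flipped_of_frequently_ne hinj h hfreq))
  · obtain ⟨b, hb⟩ := eventually_atBot.1 (not_frequently.1 hfreq)
    obtain ⟨m, hm, hmin⟩ := Int.exists_least_of_bdd (P := fun n => x.val n ≠ y.val n)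
      ⟨b, fun n hn => le_of_not_ge fun hnb => hb n hnb hn⟩
      (Function.ne_iff.1 fun hval => hxy (TwoSided.ext hval))
    exact Or.inr (tailFlip_of_forall_lt_eq hinj h0 h
      (fun n hn => not_not.1 fun hne => (hmin n hne).not_gt hn) hm)

theorem FullFlip.not_tailFlip (hinj : Function.Injective (edgeMap ξ)) (h0 : (ξ 0).onV = (ξ 1).onV)
    (h : FullFlip ξ x y) : ¬ TailFlip ξ x y := by
  obtain ⟨i, hflip⟩ := (fullFlip_iff h0).1 h
  rintro ⟨m, -, -, hlt, -⟩
  exact (hflip (m - 1)).ne hinj (hlt (m - 1) (sub_one_lt m))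

theorem piTwo_eq_iff_exactlyOne (hinj : Function.Injective (edgeMap ξ))
    (h0 : (ξ 0).onV = (ξ 1).onV) (x y : TwoSided G) :
    piTwo ξ x = piTwo ξ y ↔ ExactlyOne (x = y) (FullFlip ξ x y) (TailFlip ξ x y) := by
  constructor
  · intro h
    by_cases hxy : x = y
    · subst hxy
      refine Or.inl ⟨rfl, fun hfull => ?_, fun htail => ?_⟩
      · obtain ⟨i, hflip⟩ := (fullFlip_iff h0).1 hfull
        exact (hflip 0).ne hinj rfl
      · obtain ⟨m, i, -, -, hflip⟩ := (tailFlip_iff h0).1 htail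
        exact (hflip (m + 1) (lt_add_one m)).ne hinj rfl
    · rcases fullFlip_or_tailFlip_of_piTwo_eq hinj h0 h hxy with hfull | htail
      · exact Or.inr (Or.inl ⟨hxy, hfull, hfull.not_tailFlip hinj h0⟩)
      · exact Or.inr (Or.inr ⟨hxy, fun hfull => hfull.not_tailFlip hinj h0 htail, htail⟩)
  · rintro (⟨rfl, -⟩ | ⟨-, hfull, -⟩ | ⟨-, -, htail⟩)
    exacts [rfl, hfull.piTwo_eq h0, htail.piTwo_eq h0]

end Flips

section Fibres

variable {W F V E : Type*} {H : EdgeGraph W F} {G : EdgeGraph V E} {ξ : Fin 2 → Embedding H G}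

theorem exists_eventually_flipped_of_code_eq (hinj : Function.Injective (edgeMap ξ))
    {x y : OneSided G} (h : code ξ x = code ξ y) (hxy : x ≠ y) :
    ∃ i, ∀ᶠ k in atTop, Flipped ξ i (x.val k) (y.val k) := by
  obtain ⟨n, hn⟩ := Function.ne_iff.1 fun hval => hxy (OneSided.ext hval)
  obtain ⟨i, hi⟩ := exists_forall_flipped_succ hinj (code_iterate_shiftPos_eq h n)
    (by simpa only [iterate_shiftPos_val, zero_add] using hn)
  refine ⟨i, (eventually_gt_atTop n).mono fun k hk => ?_⟩
  obtain ⟨l, rfl⟩ := Nat.exists_eq_add_of_lt hk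
  simpa only [iterate_shiftPos_val, show l + 1 + n = n + l + 1 by omega] using hi l

theorem exists_eventually_flipped_of_piTwo_eq (hinj : Function.Injective (edgeMap ξ))
    {x y : TwoSided G} (h : piTwo ξ x = piTwo ξ y) (hxy : x ≠ y) :
    ∃ i, ∀ᶠ n in atTop, Flipped ξ i (x.val n) (y.val n) := by
  obtain ⟨m, hm⟩ := Function.ne_iff.1 fun hval => hxy (TwoSided.ext hval)
  obtain ⟨i, hi⟩ := exists_forall_gt_flipped hinj h hm
  exact ⟨i, (eventually_gt_atTop m).mono hi⟩

theorem encard_le_two_of_eventually_flipped (hinj : Function.Injective (edgeMap ξ)) {α ι : Type*}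
    {l : Filter ι} [l.NeBot] {s : Set α} (f : α → ι → E)
    (h : s.Pairwise fun a b => ∃ i, ∀ᶠ k in l, Flipped ξ i (f a k) (f b k)) : s.encard ≤ 2 := by
  by_contra! hlt
  obtain ⟨t, hts, ht⟩ := Set.exists_subset_encard_eq (k := 3) (Order.add_one_le_of_lt hlt)
  obtain ⟨a, b, c, hab, hac, hbc, rfl⟩ := Set.encard_eq_three.1 ht
  obtain ⟨ha, hb, hc⟩ : a ∈ s ∧ b ∈ s ∧ c ∈ s := by simpa [Set.insert_subset_iff] using hts
  obtain ⟨i, hi⟩ := h ha hb hab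
  obtain ⟨j, hj⟩ := h ha hc hac
  obtain ⟨p, hp⟩ := h hb hc hbc
  obtain ⟨k, hab, hac, hbc⟩ := (hi.and (hj.and hp)).exists
  exact hbc.ne hinj ((hab.eq_swapEdge hinj).trans (hac.eq_swapEdge hinj).symm)

theorem encard_fibre_le_two (hinj : Function.Injective (edgeMap ξ)) (p : InvLim ξ) :
    (piTwo ξ ⁻¹' {p}).encard ≤ 2 :=
  encard_le_two_of_eventually_flipped hinj TwoSided.val fun _ hx _ hy hxy =>
    exists_eventually_flipped_of_piTwo_eq hinj (hx.trans hy.symm) hxy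

open CategoryTheory in
theorem exists_section_of_finite {K : ℕ → Type*} [∀ n, Finite (K n)] [∀ n, Nonempty (K n)]
    (f : ∀ n, K (n + 1) → K n) : ∃ s : ∀ n, K n, ∀ n, f n (s (n + 1)) = s n := by
  let D : ℕᵒᵖ ⥤ Type _ := Functor.ofOpSequence (X := K) fun n => TypeCat.ofHom (f n)
  have (j : ℕᵒᵖ) : Finite (D.obj j) := inferInstanceAs (Finite (K j.unop))
  have (j : ℕᵒᵖ) : Nonempty (D.obj j) := inferInstanceAs (Nonempty (K j.unop))
  obtain ⟨s, hs⟩ := nonempty_sections_of_finite_inverse_system D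
  refine ⟨fun n => s ⟨n⟩, fun n => ?_⟩
  have hn := hs (homOfLE (Nat.le_succ n)).op
  rwa [Functor.ofOpSequence_map_homOfLE_succ] at hn

theorem piTwo_surjective (hinj : Function.Injective (edgeMap ξ)) :
    Function.Surjective (piTwo ξ) := by
  intro p
  let K (n : ℕ) : Set (OneSided G) := {a | piPos ξ a = p.val n}
  have (n : ℕ) : Finite (K n) :=
    Set.finite_of_encard_le_coe (k := 2) (encard_le_two_of_eventually_flipped hinj OneSided.val
      fun _ hx _ hy => exists_eventually_flipped_of_code_eq hinj
        ((piPos_eq_iff hinj).1 (hx.trans hy.symm)))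
  have (n : ℕ) : Nonempty (K n) := ⟨Quot.out (p.val n), Quot.out_eq _⟩
  have hshift (n : ℕ) (a : K (n + 1)) : shiftPos a.1 ∈ K n :=
    (congrArg (shiftQuot ξ) a.2).trans (p.compat n).symm
  obtain ⟨s, hs⟩ := exists_section_of_finite (K := fun n => K n)
    fun n a => ⟨shiftPos a.1, hshift n a⟩
  obtain ⟨x, hx⟩ := exists_tailFrom_eq (fun n => (s n).1) fun n => congrArg Subtype.val (hs n)
  exact ⟨x, InvLim.ext (funext fun n => (congrArg (piPos ξ) (hx n)).trans (s n).2)⟩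

end Fibres

section Bracket

variable {W F V E : Type*} {H : EdgeGraph W F} {G : EdgeGraph V E} {ξ : Fin 2 → Embedding H G}
  {x y : TwoSided G}

theorem code_tailFrom_succ_eq (hinj : Function.Injective (edgeMap ξ)) (h0 : (ξ 0).onV = (ξ 1).onV)
    {n : ℕ} (h : code ξ (tailFrom x n) = code ξ (tailFrom y n)) {u : OneSided G}
    (hu : Agree (n + 4) (tailFrom y (n + 1)) u)
    (hd : dOne h0 (tailFrom x (n + 1)) u ≤ 2⁻¹ ^ (n + 2)) :
    code ξ (tailFrom x (n + 1)) = code ξ (tailFrom y (n + 1)) := by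
  have hshift (v : TwoSided G) : shiftPos (tailFrom v (n + 1)) = tailFrom v n := by
    ext k
    exact congrArg v.val (by push_cast; ring)
  have hpow : (2 : ℝ)⁻¹ ^ n ≤ 1 := pow_le_one₀ (by norm_num) (by norm_num)
  rw [pow_add] at hd
  refine code_eq_of_shiftPos_of_dist_lt hinj (by rwa [hshift, hshift]) ?_ ?_
  · rw [hu 0 (Nat.succ_pos _)]
    exact edgeClass_eq_of_dOne_lt_one (hd.trans_lt (by linarith))
  · calc dist (angle ξ (tailFrom x (n + 1))) (angle ξ (tailFrom y (n + 1)))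
      _ ≤ dist (angle ξ (tailFrom x (n + 1))) (angle ξ u) +
          dist (angle ξ (tailFrom y (n + 1))) (angle ξ u) := dist_triangle_right _ _ _
      _ ≤ 2⁻¹ ^ n * 2⁻¹ ^ 2 + 2⁻¹ ^ (n + 4) :=
          add_le_add ((dist_angle_le_dOne h0 _ _).trans hd) hu.dist_angle_le
      _ < 1 / 2 := by rw [pow_add]; linarith

variable (h : dTwo x y ≤ 2⁻¹)

theorem tailFrom_bracketTwo_zero : tailFrom (bracketTwo x y h) 0 = tailFrom x 0 := by
  ext k
  exact if_neg (by push_cast; omega)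

theorem agree_tailFrom_bracketTwo (hxy : dTwo x y ≤ 2⁻¹ ^ 3) (n : ℕ) :
    Agree (n + 3) (tailFrom (bracketTwo x y h) n) (tailFrom y n) := by
  intro k hk
  change (if 1 + (k : ℤ) - n ≤ 0 then y.val _ else x.val _) = y.val _
  split_ifs
  · rfl
  · exact eq_of_dTwo_lt (N := 2) (hxy.trans_lt (by norm_num)) (by omega) (by push_cast; omega)

theorem isBracket_piTwo_bracketTwo (hinj : Function.Injective (edgeMap ξ))
    (h0 : (ξ 0).onV = (ξ 1).onV) (hd : Dense (levelPairs ξ)) (hxy : dTwo x y ≤ 2⁻¹ ^ 3) :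
    IsBracket ξ h0 (piTwo ξ x) (piTwo ξ y) (piTwo ξ (bracketTwo x y h)) := by
  refine ⟨?_, congrArg (piPos ξ) (tailFrom_bracketTwo_zero h), fun n => ?_⟩
  · exact (dLim_le_of_dTwo_lt hinj h0 hd (N := 2) (hxy.trans_lt (by norm_num))).trans (by norm_num)
  · refine (dQuot_piPos hinj h0 hd _ _).trans_le
      (((agree_tailFrom_bracketTwo h hxy n).dOne_le h0).trans ?_)
    rw [pow_add, pow_succ _ n]
    linarith [show (0 : ℝ) < 2⁻¹ ^ n by positivity]

theorem IsBracket.eq_piTwo_bracketTwo (hinj : Function.Injective (edgeMap ξ))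
    (h0 : (ξ 0).onV = (ξ 1).onV) (hd : Dense (levelPairs ξ)) (hxy : dTwo x y ≤ 2⁻¹ ^ 3)
    {z : InvLim ξ} (hz : IsBracket ξ h0 (piTwo ξ x) (piTwo ξ y) z) :
    z = piTwo ξ (bracketTwo x y h) := by
  obtain ⟨w, rfl⟩ := piTwo_surjective hinj z
  refine (piTwo_eq_iff hinj).2 fun n => ?_
  induction n with
  | zero =>
    rw [tailFrom_bracketTwo_zero]
    exact (piPos_eq_iff hinj).1 hz.2.1
  | succ n ih =>
    exact code_tailFrom_succ_eq hinj h0 ih (agree_tailFrom_bracketTwo h hxy (n + 1))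
      ((dQuot_piPos hinj h0 hd _ _).symm.trans_le (hz.2.2 (n + 1)))

end Bracket

section StableSets

variable {W F V E : Type*} {H : EdgeGraph W F} {G : EdgeGraph V E} {ξ : Fin 2 → Embedding H G}
  {x y w : TwoSided G} {i : Fin 2}

theorem exists_flipped_swapEdge (hinj : Function.Injective (edgeMap ξ)) {e : E}
    (he : e ∈ imageEdges ξ) : ∃ i, Flipped ξ i e (swapEdge ξ e) := by
  obtain ⟨i, e', h⟩ := exists_flipped_of_mem he
  exact ⟨i, h.eq_swapEdge hinj ▸ h⟩

theorem i_swapEdge (hinj : Function.Injective (edgeMap ξ)) (h0 : (ξ 0).onV = (ξ 1).onV) (e : E) :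
    G.i (swapEdge ξ e) = G.i e := by
  by_cases he : e ∈ imageEdges ξ
  · obtain ⟨i, h⟩ := exists_flipped_swapEdge hinj he
    exact (h.i_eq h0).symm
  · rw [swapEdge_of_notMem he]

theorem t_swapEdge (hinj : Function.Injective (edgeMap ξ)) (h0 : (ξ 0).onV = (ξ 1).onV) (e : E) :
    G.t (swapEdge ξ e) = G.t e := by
  by_cases he : e ∈ imageEdges ξ
  · obtain ⟨i, h⟩ := exists_flipped_swapEdge hinj he
    exact (h.t_eq h0).symm
  · rw [swapEdge_of_notMem he]

open Classical in
/-- The bi-infinite path obtained from `w` by exchanging `ξ⁰(y)` and `ξ¹(y)` at the positions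
in `s`. -/
noncomputable def swapOn (hinj : Function.Injective (edgeMap ξ)) (h0 : (ξ 0).onV = (ξ 1).onV)
    (s : Set ℤ) (w : TwoSided G) : TwoSided G where
  val n := if n ∈ s then swapEdge ξ (w.val n) else w.val n
  isPath n := by split_ifs <;> simp only [i_swapEdge hinj h0, t_swapEdge hinj h0, w.isPath]

theorem swapOn_val_of_mem (hinj : Function.Injective (edgeMap ξ)) (h0 : (ξ 0).onV = (ξ 1).onV)
    {s : Set ℤ} {n : ℤ} (hn : n ∈ s) : (swapOn hinj h0 s w).val n = swapEdge ξ (w.val n) :=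
  if_pos hn

theorem swapOn_val_of_notMem (hinj : Function.Injective (edgeMap ξ))
    (h0 : (ξ 0).onV = (ξ 1).onV) {s : Set ℤ} {n : ℤ} (hn : n ∉ s) :
    (swapOn hinj h0 s w).val n = w.val n :=
  if_neg hn

theorem tailFlip_swapOn_Ici (hinj : Function.Injective (edgeMap ξ)) (h0 : (ξ 0).onV = (ξ 1).onV)
    {m : ℤ} (hm : ¬ Flipped ξ i (w.val m) (swapEdge ξ (w.val m)))
    (hgt : ∀ n, m < n → Flipped ξ i (w.val n) (swapEdge ξ (w.val n))) :
    TailFlip ξ w (swapOn hinj h0 (Ici m) w) := by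
  refine (tailFlip_iff h0).2 ⟨m, i, fun n hn => ?_, ?_, fun n hn => ?_⟩
  · rw [swapOn_val_of_notMem hinj h0 (notMem_Ici.2 hn)]
  · rw [swapOn_val_of_mem hinj h0 self_mem_Ici]
    by_cases hmem : w.val m ∈ imageEdges ξ
    · obtain ⟨j, hj⟩ := exists_flipped_swapEdge hinj hmem
      obtain rfl := fin_two_eq_one_sub_of_ne fun hji : j = i => hm (hji ▸ hj)
      exact Or.inr hj
    · exact Or.inl ⟨(swapEdge_of_notMem hmem).symm, hmem⟩
  · rw [swapOn_val_of_mem hinj h0 (mem_Ici.2 hn.le)]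
    exact hgt n hn

-- The fibre partner of `w` is found by exchanging `ξ⁰` and `ξ¹` as far to the left as possible.
theorem exists_piTwo_eq_and_eventually_eq (hinj : Function.Injective (edgeMap ξ))
    (h0 : (ξ 0).onV = (ξ 1).onV) (h : ∀ᶠ n in atTop, Flipped ξ i (w.val n) (x.val n)) :
    ∃ y, piTwo ξ y = piTwo ξ w ∧ ∀ᶠ n in atTop, x.val n = y.val n := by
  have hx : ∀ᶠ n in atTop, x.val n = swapEdge ξ (w.val n) := h.mono fun n hn => hn.eq_swapEdge hinj
  have hflip : ∀ᶠ n in atTop, Flipped ξ i (w.val n) (swapEdge ξ (w.val n)) := by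
    filter_upwards [h, hx] with n hn hxn
    rwa [← hxn]
  by_cases hall : ∀ n, Flipped ξ i (w.val n) (swapEdge ξ (w.val n))
  · refine ⟨swapOn hinj h0 univ w,
      (FullFlip.piTwo_eq h0 ((fullFlip_iff h0).2 ⟨i, fun n => ?_⟩)).symm,
      hx.mono fun n hn => hn.trans (swapOn_val_of_mem hinj h0 (mem_univ n)).symm⟩
    rw [swapOn_val_of_mem hinj h0 (mem_univ n)]
    exact hall n
  · obtain ⟨b, hb⟩ := eventually_atTop.1 hflip
    obtain ⟨m, hm, hmax⟩ := Int.exists_greatest_of_bdd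
      (P := fun n => ¬ Flipped ξ i (w.val n) (swapEdge ξ (w.val n)))
      ⟨b, fun n hn => le_of_not_ge fun hbn => hn (hb n hbn)⟩ (not_forall.1 hall)
    refine ⟨swapOn hinj h0 (Ici m) w, ((tailFlip_swapOn_Ici hinj h0 hm fun n hn =>
      not_not.1 fun hne => (hmax n hne).not_gt hn).piTwo_eq h0).symm, ?_⟩
    filter_upwards [hx, eventually_ge_atTop m] with n hn hmn
    exact hn.trans (swapOn_val_of_mem hinj h0 (mem_Ici.2 hmn)).symm

theorem piTwo_mem_stableSet (hinj : Function.Injective (edgeMap ξ)) (h0 : (ξ 0).onV = (ξ 1).onV)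
    (hd : Dense (levelPairs ξ)) (h : y ∈ stableSet dTwo shiftTwo x) :
    piTwo ξ y ∈ stableSet (dLim ξ h0) (shiftLim ξ) (piTwo ξ x) := by
  change Tendsto _ _ _
  simp only [iterate_shiftLim_piTwo]
  refine tendsto_order.2 ⟨fun η hη => Eventually.of_forall fun n =>
    hη.trans_le (dLim_nonneg hinj h0 hd _ _), fun η hη => ?_⟩
  obtain ⟨δ, hδ, hlt⟩ := exists_dLim_lt hinj h0 hd hη
  exact ((tendsto_order.1 h).2 δ hδ).mono fun n hn => hlt _ _ hn

theorem exists_code_pathAt_eq (hinj : Function.Injective (edgeMap ξ))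
    (h0 : (ξ 0).onV = (ξ 1).onV) (hd : Dense (levelPairs ξ))
    (h : piTwo ξ w ∈ stableSet (dLim ξ h0) (shiftLim ξ) (piTwo ξ x)) :
    ∃ m, code ξ (pathAt w m) = code ξ (pathAt x m) := by
  change Tendsto _ _ _ at h
  simp only [iterate_shiftLim_piTwo] at h
  obtain ⟨N, hN⟩ := eventually_atTop.1 ((tendsto_order.1 h).2 (1 / 4) (by norm_num))
  have hlt (n : ℕ) : dOne h0 (shiftPos^[n] (pathAt x (1 + N))) (shiftPos^[n] (pathAt w (1 + N))) <
      1 / 4 := by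
    have hdn := (dOne_tailFrom_zero_le_dLim hinj h0 hd _ _).trans_lt (hN (N + n) (N.le_add_right n))
    rw [tailFrom_iterate_shiftTwo, tailFrom_iterate_shiftTwo] at hdn
    simpa only [tailFrom_eq_pathAt, iterate_shiftPos_pathAt, Nat.cast_add, Nat.cast_zero, sub_zero,
      add_assoc] using hdn
  refine ⟨1 + N, (code_eq_of_dist_angle_le hinj (fun n => ?_) fun n =>
    (dist_angle_le_dOne h0 _ _).trans (hlt n).le).symm⟩
  simpa only [iterate_shiftPos_val, zero_add] using
    edgeClass_eq_of_dOne_lt_one ((hlt n).trans (by norm_num))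

theorem eventually_eq_or_exists_eventually_flipped (hinj : Function.Injective (edgeMap ξ)) {m : ℤ}
    (h : code ξ (pathAt w m) = code ξ (pathAt x m)) :
    (∀ᶠ n in atTop, x.val n = w.val n) ∨
      ∃ i, ∀ᶠ n in atTop, Flipped ξ i (w.val n) (x.val n) := by
  have hshift {p : ℤ → Prop} (hp : ∀ᶠ k : ℕ in atTop, p (m + k)) : ∀ᶠ n in atTop, p n := by
    obtain ⟨b, hb⟩ := eventually_atTop.1 hp
    filter_upwards [eventually_ge_atTop (m + b)] with n hn
    obtain ⟨k, rfl⟩ := Int.exists_add_of_le hn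
    exact_mod_cast add_assoc m (b : ℤ) k ▸ hb (b + k) (b.le_add_right k)
  by_cases hwx : pathAt w m = pathAt x m
  · exact Or.inl (hshift (Eventually.of_forall fun k => (congrArg (fun u => u.val k) hwx).symm))
  · obtain ⟨i, hi⟩ := exists_eventually_flipped_of_code_eq hinj h hwx
    exact Or.inr ⟨i, hshift hi⟩

theorem surjOn_stableSet (hinj : Function.Injective (edgeMap ξ)) (h0 : (ξ 0).onV = (ξ 1).onV)
    (hd : Dense (levelPairs ξ)) (x : TwoSided G) :
    SurjOn (piTwo ξ) (stableSet dTwo shiftTwo x)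
      (stableSet (dLim ξ h0) (shiftLim ξ) (piTwo ξ x)) := by
  intro p hp
  obtain ⟨w, rfl⟩ := piTwo_surjective hinj p
  obtain ⟨m, hm⟩ := exists_code_pathAt_eq hinj h0 hd hp
  rcases eventually_eq_or_exists_eventually_flipped hinj hm with heq | ⟨i, hflip⟩
  · exact ⟨w, mem_stableSet_dTwo_iff.2 heq, rfl⟩
  · obtain ⟨y, hyw, hxy⟩ := exists_piTwo_eq_and_eventually_eq hinj h0 hflip
    exact ⟨y, mem_stableSet_dTwo_iff.2 hxy, hyw⟩

theorem bijOn_stableSet (hinj : Function.Injective (edgeMap ξ)) (h0 : (ξ 0).onV = (ξ 1).onV)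
    (hd : Dense (levelPairs ξ)) (x : TwoSided G) :
    BijOn (piTwo ξ) (stableSet dTwo shiftTwo x)
      (stableSet (dLim ξ h0) (shiftLim ξ) (piTwo ξ x)) := by
  refine ⟨fun y hy => piTwo_mem_stableSet hinj h0 hd hy, fun y hy y' hy' h => ?_,
    surjOn_stableSet hinj h0 hd x⟩
  by_contra hne
  obtain ⟨i, hflip⟩ := exists_eventually_flipped_of_piTwo_eq hinj h hne
  obtain ⟨n, hxy, hxy', hn⟩ := ((mem_stableSet_dTwo_iff.1 hy).and
    ((mem_stableSet_dTwo_iff.1 hy').and hflip)).exists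
  exact hn.ne hinj (hxy.symm.trans hxy')

end StableSets

end XiFactor

theorem theorem4p3_general {W F V E : Type*}
    (H : XiFactor.EdgeGraph W F) (G : XiFactor.EdgeGraph V E)
    (ξ : Fin 2 → XiFactor.Embedding H G)
    (h0 : (ξ 0).onV = (ξ 1).onV)
    (h1 : range (ξ 0).onE ∩ range (ξ 1).onE = ∅)
    (hd : Dense (XiFactor.levelPairs ξ)) :
    (Continuous (XiFactor.piTwo ξ) ∧
      (∀ x : XiFactor.TwoSided G, ∀ η : ℝ, 0 < η → ∃ δ : ℝ, 0 < δ ∧ ∀ y : XiFactor.TwoSided G,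
        XiFactor.dTwo x y < δ →
          XiFactor.dLim ξ h0 (XiFactor.piTwo ξ x) (XiFactor.piTwo ξ y) < η) ∧
      Function.Surjective (XiFactor.piTwo ξ) ∧
      ∀ x : XiFactor.TwoSided G,
        XiFactor.piTwo ξ (XiFactor.shiftTwo x) = XiFactor.shiftLim ξ (XiFactor.piTwo ξ x)) ∧
    (∀ x y : XiFactor.TwoSided G, XiFactor.dTwo x y ≤ (2 : ℝ)⁻¹ ^ 3 →
      ∃ h : XiFactor.dTwo x y ≤ 2⁻¹, ∀ z : XiFactor.InvLim ξ,
        XiFactor.IsBracket ξ h0 (XiFactor.piTwo ξ x) (XiFactor.piTwo ξ y) z ↔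
          z = XiFactor.piTwo ξ (XiFactor.bracketTwo x y h)) ∧
    (∀ x y : XiFactor.TwoSided G, XiFactor.piTwo ξ x = XiFactor.piTwo ξ y ↔
      XiFactor.ExactlyOne (x = y) (XiFactor.FullFlip ξ x y) (XiFactor.TailFlip ξ x y)) ∧
    (∀ p : XiFactor.InvLim ξ, (XiFactor.piTwo ξ ⁻¹' {p}).encard ≤ 2) ∧
    (∀ x : XiFactor.TwoSided G,
      Set.BijOn (XiFactor.piTwo ξ)
        (XiFactor.stableSet XiFactor.dTwo XiFactor.shiftTwo x)
        (XiFactor.stableSet (XiFactor.dLim ξ h0) (XiFactor.shiftLim ξ)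
          (XiFactor.piTwo ξ x))) := by
  have hinj := XiFactor.edgeMap_injective h1
  refine ⟨⟨XiFactor.continuous_piTwo, fun x η hη => ?_, XiFactor.piTwo_surjective hinj,
    XiFactor.piTwo_shiftTwo⟩, fun x y hxy => ?_, XiFactor.piTwo_eq_iff_exactlyOne hinj h0,
    XiFactor.encard_fibre_le_two hinj, XiFactor.bijOn_stableSet hinj h0 hd⟩
  · obtain ⟨δ, hδ, hlt⟩ := XiFactor.exists_dLim_lt hinj h0 hd hη
    exact ⟨δ, hδ, hlt x⟩
  · have h : XiFactor.dTwo x y ≤ 2⁻¹ := hxy.trans (by norm_num)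
    refine ⟨h, fun z => ⟨XiFactor.IsBracket.eq_piTwo_bracketTwo h hinj h0 hd hxy, ?_⟩⟩
    rintro rfl
    exact XiFactor.isBracket_piTwo_bracketTwo h hinj h0 hd hxy

theorem theorem4p3 {W F V E : Type*} [Finite W] [Finite F] [Fintype V] [DecidableEq V] [Finite E]
    (H : XiFactor.EdgeGraph W F) (G : XiFactor.EdgeGraph V E)
    (ξ : Fin 2 → XiFactor.Embedding H G)
    (hξ : XiFactor.StandingHypotheses ξ)
    (hH : Nonempty (XiFactor.TwoSided H)) :
    -- `π_ξ` is a factor map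
    (Continuous (XiFactor.piTwo ξ) ∧
      (∀ x : XiFactor.TwoSided G, ∀ η : ℝ, 0 < η → ∃ δ : ℝ, 0 < δ ∧ ∀ y : XiFactor.TwoSided G,
        XiFactor.dTwo x y < δ →
          XiFactor.dLim ξ hξ.h0 (XiFactor.piTwo ξ x) (XiFactor.piTwo ξ y) < η) ∧
      Function.Surjective (XiFactor.piTwo ξ) ∧
      ∀ x : XiFactor.TwoSided G,
        XiFactor.piTwo ξ (XiFactor.shiftTwo x) = XiFactor.shiftLim ξ (XiFactor.piTwo ξ x)) ∧
    -- both brackets are defined for `d_G(x, y) ≤ 2⁻³`, and `π_ξ` commutes with them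
    (∀ x y : XiFactor.TwoSided G, XiFactor.dTwo x y ≤ (2 : ℝ)⁻¹ ^ 3 →
      ∃ h : XiFactor.dTwo x y ≤ 2⁻¹, ∀ z : XiFactor.InvLim ξ,
        XiFactor.IsBracket ξ hξ.h0 (XiFactor.piTwo ξ x) (XiFactor.piTwo ξ y) z ↔
          z = XiFactor.piTwo ξ (XiFactor.bracketTwo x y h)) ∧
    -- pairs with the same image, and the size of the fibres
    (∀ x y : XiFactor.TwoSided G, XiFactor.piTwo ξ x = XiFactor.piTwo ξ y ↔
      XiFactor.ExactlyOne (x = y) (XiFactor.FullFlip ξ x y) (XiFactor.TailFlip ξ x y)) ∧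
    (∀ p : XiFactor.InvLim ξ, (XiFactor.piTwo ξ ⁻¹' {p}).encard ≤ 2) ∧
    -- `π_ξ` is `s`-bijective
    (∀ x : XiFactor.TwoSided G,
      Set.BijOn (XiFactor.piTwo ξ)
        (XiFactor.stableSet XiFactor.dTwo XiFactor.shiftTwo x)
        (XiFactor.stableSet (XiFactor.dLim ξ hξ.h0) (XiFactor.shiftLim ξ)
          (XiFactor.piTwo ξ x))) := by
  exact theorem4p3_general H G ξ hξ.h0 hξ.h1 (XiFactor.dense_levelPairs hξ hH)
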